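/- Let $\alpha>-1$ and $z>0$. Let $(P_n)_{n\ge 0}$ be the monic orthogonal polynomials for $\langle \ell,p\rangle=\int_0^z p(x)x^{\alpha}e^{-x}\,dx$, with recurrence $xP_n=P_{n+1}+b_nP_n+a_nP_{n-1}$, and let $(Q_n)_{n\ge 0}$ be those for $p\mapsto\langle \ell,xp\rangle$. Put $S_{2n}(x)=P_n(x^2)$ and $S_{2n+1}(x)=xQ_n(x^2)$; these are the monic orthogonal polynomials for $\langle h,p\rangle=\int_{-\sqrt z}^{\sqrt z}p(x)|x|^{2\alpha+1}e^{-x^2}\,dx$, with recurrence $xS_n=S_{n+1}+\gamma_nS_{n-1}$. (In both recurrences the polynomial of index $-1$ is $0$, that of index $0$ is $1$.) For a function $V$ let $$E_V(x_1,\dots,x_N)=2\sum_{1\le j<k\le N}\ln\frac1{|x_j-x_k|}+\sum_{k=1}^N V(x_k).$$ Then for every $n\ge 0$: **(a) Zeros of $P_{n+1}$.** Let $\beta_n=-b_{n+1}+(2n+\alpha+z+3)$ and $$V_P(x)=\ln\frac1{|x-z|}+\ln\frac1{|x|}-\ln\frac1{|x-\beta_n|}+x-\alpha\ln x,\qquad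 0<x<z.$$ Then $\beta_n>z$. The polynomial $P_{n+1}$ has $n+1$ simple real zeros $x_1<\dots<x_{n+1}$, all in $(0,z)$, and they are an equilibrium of $n+1$ unit charges in the external field $V_P$: $\partial E_{V_P}/\partial x_k=0$ at $(x_1,\dots,x_{n+1})$ for $1\le k\le n+1$. It is the only equilibrium $x_1<\dots<x_{n+1}$ with all charges in $(0,z)$. **(b) Zeros of $S_{n+1}$.** Let $\rho_n=(n+1)+\alpha+z+1-\gamma_{n+1}-\gamma_{n+2}$ and $$V_S(x)=\ln\frac1{|x-\sqrt z|}+\ln\frac1{|x+\sqrt z|}-\ln\frac1{|x-\sqrt{\rho_n}|}-\ln\frac1{|x+\sqrt{\rho_n}|}+x^2-(2\alpha+1)\ln|x|,\qquad -\sqrt z<x<\sqrt z.$$ Then $\rho_n>z$. The polynomial $S_{n+1}$ has $n+1$ simple real zeros $y_1<\dots<y_{n+1}$, all in $(-\sqrt z,\sqrt z)$, and at $(y_1,\dots,y_{n+1})$ one has $\partial E_{V_S}/\partial x_k=0$ for every $k$ with $y_k\ne0$. If $y_k=0$ (which happens for one $k$ when $n+1$ is odd), then $\partial E_{V}/\partial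 x_k=0$ at $(y_1,\dots,y_{n+1})$ for $V(x)=V_S(x)+(2\alpha+1)\ln|x|$, the field without its term that is singular at the origin. (Here the terms of $E$ that do not depend on $x_k$ are treated as constants.) -/

import Mathlib

open Polynomial

noncomputable section

namespace TruncatedLaguerre

/-- `P` is a sequence of monic orthogonal polynomials for the functional `u`:
`P n` is monic of degree `n` and `⟨u, P m * P n⟩ = K n * δ` with `K n ≠ 0`. -/
def IsSMOP (u : ℝ[X] → ℝ) (P : ℕ → ℝ[X]) : Prop :=
  (∀ n, (P n).Monic ∧ (P n).natDegree = n) ∧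
  (∀ m n, m ≠ n → u (P m * P n) = 0) ∧
  (∀ n, u (P n * P n) ≠ 0)

/-- The three-term recurrence
`x P_n = P_{n+1} + b_n P_n + a_n P_{n-1}`, `P_{-1} = 0`, `P_0 = 1`. -/
def HasThreeTermRecurrence (P : ℕ → ℝ[X]) (b a : ℕ → ℝ) : Prop :=
  P 0 = 1 ∧ X * P 0 = P 1 + C (b 0) * P 0 ∧
  ∀ n, X * P (n + 1) = P (n + 2) + C (b (n + 1)) * P (n + 1) + C (a (n + 1)) * P n

/-- The monic orthogonal polynomials of `u`, by Gram–Schmidt on `1, x, x², …`. -/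
def monicOrthPoly (u : ℝ[X] → ℝ) (n : ℕ) : ℝ[X] :=
  X ^ n - ∑ k : Fin n,
    C (u (X ^ n * monicOrthPoly u k) / u (monicOrthPoly u k * monicOrthPoly u k)) *
      monicOrthPoly u k
termination_by n
decreasing_by all_goals exact k.isLt

/-- The recurrence coefficient `⟨u, x P_n²⟩ / ⟨u, P_n²⟩` of a sequence `P` orthogonal for `u`. -/
def diagCoeff (u : ℝ[X] → ℝ) (P : ℕ → ℝ[X]) (n : ℕ) : ℝ :=
  u (X * (P n * P n)) / u (P n * P n)

/-- The recurrence coefficient `⟨u, P_n²⟩ / ⟨u, P_{n-1}²⟩` for `n ≥ 1`, and `0` for `n = 0`. -/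
def subdiagCoeff (u : ℝ[X] → ℝ) (P : ℕ → ℝ[X]) : ℕ → ℝ
  | 0 => 0
  | n + 1 => u (P (n + 1) * P (n + 1)) / u (P n * P n)

/-- The truncated Laguerre functional `⟨ℓ, p⟩ = ∫₀ᶻ p(x) x^α e^{-x} dx`. -/
def laguerreFunctional (α z : ℝ) (p : ℝ[X]) : ℝ :=
  ∫ x in (0 : ℝ)..z, p.eval x * x ^ α * Real.exp (-x)

/-- The truncated generalized Hermite functional
`⟨h, p⟩ = ∫_{-√z}^{√z} p(x) |x|^{2α+1} e^{-x²} dx`. -/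
def hermiteFunctional (α z : ℝ) (p : ℝ[X]) : ℝ :=
  ∫ x in (-√z)..√z, p.eval x * |x| ^ (2 * α + 1) * Real.exp (-x ^ 2)

/-- The truncated Laguerre polynomials `P_n(x; z)`. -/
def polyP (α z : ℝ) (n : ℕ) : ℝ[X] := monicOrthPoly (laguerreFunctional α z) n

/-- The monic orthogonal polynomials `Q_n(x; z)` of the functional `x ℓ`. -/
def polyQ (α z : ℝ) (n : ℕ) : ℝ[X] :=
  monicOrthPoly (fun p => laguerreFunctional α z (X * p)) n

/-- The symmetrized polynomials: `S_{2n}(x) = P_n(x²)`, `S_{2n+1}(x) = x Q_n(x²)`. -/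
def polyS (α z : ℝ) (n : ℕ) : ℝ[X] :=
  if Even n then (polyP α z (n / 2)).comp (X ^ 2) else X * (polyQ α z (n / 2)).comp (X ^ 2)

/-- The coefficients `b_n` of the recurrence for `P_n`. -/
def coeffB (α z : ℝ) (n : ℕ) : ℝ := diagCoeff (laguerreFunctional α z) (polyP α z) n

/-- The coefficients `a_n` of the recurrence for `P_n`. -/
def coeffA (α z : ℝ) (n : ℕ) : ℝ := subdiagCoeff (laguerreFunctional α z) (polyP α z) n

/-- The coefficients `γ_n` of the recurrence `x S_n = S_{n+1} + γ_n S_{n-1}`. -/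
def coeffγ (α z : ℝ) (n : ℕ) : ℝ := subdiagCoeff (hermiteFunctional α z) (polyS α z) n

/-- `β_n = -b_{n+1} + (2n + α + z + 3)`. -/
def chargeβ (α z : ℝ) (n : ℕ) : ℝ := -coeffB α z (n + 1) + (2 * n + α + z + 3)

/-- `ρ_n = (n + 1) + α + z + 1 - γ_{n+1} - γ_{n+2}`. -/
def chargeρ (α z : ℝ) (n : ℕ) : ℝ :=
  (n + 1) + α + z + 1 - coeffγ α z (n + 1) - coeffγ α z (n + 2)

/-- The external potential `V_P` with extra charge at `β`. -/
def potentialP (α z β x : ℝ) : ℝ :=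
  Real.log (1 / |x - z|) + Real.log (1 / |x|) - Real.log (1 / |x - β|)
    + (x - α * Real.log x)

/-- The part of `V_S` without the term `-(2α+1) ln|x|`; the extra charges are at `±√ρ`. -/
def potentialSReg (z ρ x : ℝ) : ℝ :=
  Real.log (1 / |x - √z|) + Real.log (1 / |x + √z|)
    - Real.log (1 / |x - √ρ|) - Real.log (1 / |x + √ρ|) + x ^ 2

/-- The external potential `V_S`. -/
def potentialS (α z ρ x : ℝ) : ℝ :=
  potentialSReg z ρ x - (2 * α + 1) * Real.log |x|

/-- The energy of unit charges at `x 0, …, x (N-1)` in the external field `V`: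
`2 ∑_{j<k} ln (1 / |x_j - x_k|) + ∑_k V(x_k)`. -/
def energy (V : ℝ → ℝ) {N : ℕ} (x : Fin N → ℝ) : ℝ :=
  2 * ∑ j : Fin N, ∑ k ∈ Finset.Ioi j, Real.log (1 / |x j - x k|) + ∑ k : Fin N, V (x k)

/-- The `k`-th charge is in equilibrium: `∂E/∂x_k` exists and vanishes at `x`. -/
def InEquilibriumAt (V : ℝ → ℝ) {N : ℕ} (x : Fin N → ℝ) (k : Fin N) : Prop :=
  HasDerivAt (fun t => energy V (Function.update x k t)) 0 (x k)

end TruncatedLaguerre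

end

noncomputable section

namespace TruncatedLaguerre

/-! An equilibrium at the simple zeros of `p` is a second-order differential relation: `p'' / p'` at
`x_k` is `2 ∑ 1 / (x_k - x_j)`, so charge `k` is at rest exactly when `p'' = V' p'` there
(`inEquilibriumAt_iff_derivative`). It remains to find that relation for `P_{n+1}` and to read the
external field off it.

Integration by parts against `x^α e^{-x}` on `(0, z)` leaves a boundary term at `z` only. Test
functions divisible by `z - x` remove it, which gives a Pearson equation with `φ = x (z - x)` and a
quadratic `ψ`. The operator `L q = φ q'' + ψ q'` is symmetric and raises the degree by at most one,
so `L P_{n+1}` lies in the span of `P_{n+2}, P_{n+1}, P_n`; `φ P_{n+1}'` has a similar short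
expansion. At a zero `x` of `P_{n+1}` the recurrence makes both multiples of `a_{n+1} P_n(x)`, and
comparing them gives `φ P' = (x - β_n) L P`, which is `P'' = V_P' P'`. The same integration by parts
with `P_n²`, boundary term kept, bounds `b_n` and yields `β_n > z` (`diagCoeff_lt`). Then `V_P'` is
strictly increasing, and monotonicity of the pair forces gives uniqueness (`equilibrium_unique`).

For `S_n`, the substitution `x = y²` transports everything: `Q_n` is `P_n` with `α + 1` in place of
`α`, and `γ_{n+1} + γ_{n+2}` is a diagonal recurrence coefficient of one of these two families, so
`ρ_n` is essentially a `β`. A zero at the origin is handled by parity. -/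

/-- `u` is strictly positive on the nonzero polynomials that are nonnegative on `(a, b)`. -/
def PositiveOn (u : ℝ[X] →ₗ[ℝ] ℝ) (a b : ℝ) : Prop :=
  ∀ p : ℝ[X], p ≠ 0 → (∀ x ∈ Set.Ioo a b, 0 ≤ p.eval x) → 0 < u p

/-! ### Orthogonal polynomials of a positive functional: recurrence and zeros. -/

section Orthogonal

variable {u : ℝ[X] →ₗ[ℝ] ℝ} {P : ℕ → ℝ[X]} {a b : ℝ}

theorem PositiveOn.mul_self_pos (hu : PositiveOn u a b) {p : ℝ[X]} (hp : p ≠ 0) :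
    0 < u (p * p) :=
  hu _ (mul_ne_zero hp hp) fun x _ => by rw [eval_mul]; exact mul_self_nonneg _

theorem map_C_mul (u : ℝ[X] →ₗ[ℝ] ℝ) (c : ℝ) (p : ℝ[X]) : u (C c * p) = c * u p := by
  rw [← smul_eq_C_mul, map_smul, smul_eq_mul]

theorem monicOrthPoly_monic_natDegree (u : ℝ[X] → ℝ) (n : ℕ) :
    (monicOrthPoly u n).Monic ∧ (monicOrthPoly u n).natDegree = n := by
  induction n using Nat.strong_induction_on with
  | _ n ih =>
    have hlt : (∑ k : Fin n,
        C (u (X ^ n * monicOrthPoly u k) / u (monicOrthPoly u k * monicOrthPoly u k)) *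
          monicOrthPoly u k).degree < n := by
      refine (degree_sum_le _ _).trans_lt ?_
      refine (Finset.sup_lt_iff (WithBot.bot_lt_coe n)).2 fun k _ => ?_
      refine degree_le_natDegree.trans_lt (Nat.cast_lt.2 ?_)
      exact (natDegree_C_mul_le _ _).trans_lt ((ih k k.isLt).2.trans_lt k.isLt)
    rw [monicOrthPoly]
    refine ⟨monic_X_pow_sub hlt, ?_⟩
    exact natDegree_eq_of_degree_eq_some (by
      rw [degree_sub_eq_left_of_degree_lt (by rwa [degree_X_pow]), degree_X_pow])

theorem monicOrthPoly_orthogonal (hu : PositiveOn u a b) (n k : ℕ) (hk : k < n) :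
    u (monicOrthPoly u n * monicOrthPoly u k) = 0 := by
  induction n using Nat.strong_induction_on generalizing k with
  | _ n ih =>
    have horth : ∀ j < n, ∀ i < n, j ≠ i → u (monicOrthPoly u j * monicOrthPoly u i) = 0 := by
      intro j hj i hi hne
      rcases lt_or_gt_of_ne hne with h | h
      · rw [mul_comm]; exact ih i hi j h
      · exact ih j hj i h
    rw [monicOrthPoly, sub_mul, map_sub, Finset.sum_mul, map_sum,
      Finset.sum_eq_single (⟨k, hk⟩ : Fin n)]
    · have h0 := (hu.mul_self_pos (monicOrthPoly_monic_natDegree u k).1.ne_zero).ne'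
      rw [mul_assoc, map_C_mul]
      field_simp
      ring
    · intro j _ hj
      rw [mul_assoc, map_C_mul, horth j j.isLt k hk (fun h => hj (Fin.ext h)), mul_zero]
    · simp

theorem isSMOP_monicOrthPoly (hu : PositiveOn u a b) : IsSMOP u (monicOrthPoly u) := by
  refine ⟨monicOrthPoly_monic_natDegree u, fun m n hmn => ?_, fun n =>
    (hu.mul_self_pos (monicOrthPoly_monic_natDegree u n).1.ne_zero).ne'⟩
  rcases lt_or_gt_of_ne hmn with h | h
  · rw [mul_comm]; exact monicOrthPoly_orthogonal hu n m h
  · exact monicOrthPoly_orthogonal hu m n h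

namespace IsSMOP

theorem monic (h : IsSMOP u P) (n : ℕ) : (P n).Monic := (h.1 n).1

theorem natDegree_eq (h : IsSMOP u P) (n : ℕ) : (P n).natDegree = n := (h.1 n).2

theorem degree_eq (h : IsSMOP u P) (n : ℕ) : (P n).degree = n := by
  rw [degree_eq_natDegree (h.monic n).ne_zero, h.natDegree_eq]

theorem coeff_self (h : IsSMOP u P) (n : ℕ) : (P n).coeff n = 1 := by
  have := (h.monic n).coeff_natDegree
  rwa [h.natDegree_eq] at this

theorem zero_eq_one (h : IsSMOP u P) : P 0 = 1 :=
  (h.monic 0).natDegree_eq_zero.1 (h.natDegree_eq 0)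

theorem degree_sub_C_coeff_mul_lt (h : IsSMOP u P) {q : ℝ[X]} {n : ℕ} (hq : q.natDegree ≤ n) :
    (q - C (q.coeff n) * P n).degree < n := by
  rw [degree_lt_iff_coeff_zero]
  intro m hm
  rcases hm.eq_or_lt with rfl | hm
  · rw [coeff_sub, coeff_C_mul, h.coeff_self, mul_one, sub_self]
  · rw [coeff_sub, coeff_C_mul, coeff_eq_zero_of_natDegree_lt (hq.trans_lt hm),
      coeff_eq_zero_of_natDegree_lt ((h.natDegree_eq n).trans_lt hm), mul_zero, sub_self]

/-- Every statement that is linear in `q` and holds for `P 0, …, P (n-1)` holds for `deg q < n`. -/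
theorem map_eq_zero_of_degree_lt (h : IsSMOP u P) (v : ℝ[X] →ₗ[ℝ] ℝ) {n : ℕ}
    (hv : ∀ k < n, v (P k) = 0) {q : ℝ[X]} (hq : q.degree < n) : v q = 0 := by
  induction n generalizing q with
  | zero =>
    have : q = 0 := by simpa using hq
    simp [this]
  | succ n ih =>
    have hle : q.natDegree ≤ n := natDegree_le_iff_coeff_eq_zero.2 fun m hm =>
      (degree_lt_iff_coeff_zero _ _).1 hq m hm
    have := ih (fun k hk => hv k (hk.trans n.lt_succ_self)) (h.degree_sub_C_coeff_mul_lt hle)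
    rwa [map_sub, map_C_mul, hv n n.lt_succ_self, mul_zero, sub_zero] at this

theorem mul_eq_zero_of_degree_lt (h : IsSMOP u P) {n : ℕ} {q : ℝ[X]} (hq : q.degree < n) :
    u (P n * q) = 0 :=
  h.map_eq_zero_of_degree_lt (u ∘ₗ LinearMap.mulLeft ℝ (P n))
    (fun k hk => h.2.1 n k hk.ne') hq

theorem mul_eq_coeff_mul (h : IsSMOP u P) {n : ℕ} {q : ℝ[X]} (hq : q.natDegree ≤ n) :
    u (P n * q) = q.coeff n * u (P n * P n) := by
  have := h.mul_eq_zero_of_degree_lt (h.degree_sub_C_coeff_mul_lt hq)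
  rwa [mul_sub, map_sub, mul_left_comm, map_C_mul, sub_eq_zero] at this

/-- Such a `g` is orthogonal to itself, so positivity kills it. With the next lemma this is how
every expansion below is proved: bound the degree of the difference of the two sides, compare top
coefficients, test against each `P k`. -/
theorem eq_zero_of_orthogonal (h : IsSMOP u P) (hu : PositiveOn u a b) {n : ℕ} {g : ℝ[X]}
    (hg : g.degree < n) (ho : ∀ k < n, u (g * P k) = 0) : g = 0 := by
  by_contra hne
  exact (hu.mul_self_pos hne).ne'
    (h.map_eq_zero_of_degree_lt (u ∘ₗ LinearMap.mulLeft ℝ g) ho hg)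

theorem eq_zero_of_natDegree_le (h : IsSMOP u P) (hu : PositiveOn u a b) {n : ℕ} {g : ℝ[X]}
    (hg : g.natDegree ≤ n) (hc : g.coeff n = 0) (ho : ∀ k < n, u (g * P k) = 0) : g = 0 := by
  refine h.eq_zero_of_orthogonal hu (n := n) ?_ ho
  simpa [hc] using h.degree_sub_C_coeff_mul_lt hg

theorem natDegree_X_mul_le (h : IsSMOP u P) (n : ℕ) : (X * P n).natDegree ≤ n + 1 := by
  rw [natDegree_X_mul (h.monic n).ne_zero, h.natDegree_eq]

theorem mul_X_mul_succ (h : IsSMOP u P) (n : ℕ) :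
    u (P (n + 1) * (X * P n)) = u (P (n + 1) * P (n + 1)) := by
  rw [h.mul_eq_coeff_mul (h.natDegree_X_mul_le n),
    coeff_X_mul, h.coeff_self, one_mul]

theorem mul_X_mul_of_lt (h : IsSMOP u P) {n k : ℕ} (hk : k + 1 < n) :
    u (P n * (X * P k)) = 0 := by
  refine h.mul_eq_zero_of_degree_lt ?_
  rw [degree_mul, degree_X, h.degree_eq]
  exact_mod_cast (by omega : 1 + k < n)

theorem hasThreeTermRecurrence (h : IsSMOP u P) (hu : PositiveOn u a b) :
    HasThreeTermRecurrence P (diagCoeff u P) (subdiagCoeff u P) := by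
  have hb : ∀ n, diagCoeff u P n * u (P n * P n) = u (X * (P n * P n)) := fun n =>
    div_mul_cancel₀ _ (h.2.2 n)
  have ha : ∀ n, subdiagCoeff u P (n + 1) * u (P n * P n) = u (P (n + 1) * P (n + 1)) := fun n =>
    div_mul_cancel₀ _ (h.2.2 n)
  have hC : ∀ (c : ℝ) (n : ℕ), (C c * P n).natDegree ≤ n := fun c n =>
    (natDegree_C_mul_le _ _).trans (h.natDegree_eq n).le
  refine ⟨h.zero_eq_one, ?_, fun n => ?_⟩
  · rw [← sub_eq_zero]
    refine h.eq_zero_of_natDegree_le hu (n := 1) ?_ ?_ ?_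
    · have := natDegree_add_le_of_degree_le (h.natDegree_eq 1).le
        ((hC (diagCoeff u P 0) 0).trans zero_le_one)
      exact (natDegree_sub_le _ _).trans (max_le (h.natDegree_X_mul_le 0) this)
    · have h1 : (P 0).coeff 1 = 0 :=
        coeff_eq_zero_of_natDegree_lt (by rw [h.natDegree_eq]; exact zero_lt_one)
      rw [coeff_sub, coeff_add, coeff_X_mul, coeff_C_mul, h.coeff_self, h.coeff_self, h1]
      ring
    · intro k hk
      obtain rfl : k = 0 := by omega
      rw [sub_mul, add_mul, mul_assoc, mul_assoc, map_sub, map_add, map_C_mul, hb,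
        h.2.1 1 0 one_ne_zero]
      ring
  · rw [← sub_eq_zero]
    have hz1 : (P (n + 1)).coeff (n + 2) = 0 :=
      coeff_eq_zero_of_natDegree_lt (by rw [h.natDegree_eq]; omega)
    have hz0 : (P n).coeff (n + 2) = 0 :=
      coeff_eq_zero_of_natDegree_lt (by rw [h.natDegree_eq]; omega)
    refine h.eq_zero_of_natDegree_le hu (n := n + 2) ?_ ?_ ?_
    · have h1 : (C (diagCoeff u P (n + 1)) * P (n + 1)).natDegree ≤ n + 2 :=
        (hC _ _).trans (Nat.le_succ _)
      have h2 : (C (subdiagCoeff u P (n + 1)) * P n).natDegree ≤ n + 2 :=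
        (hC _ _).trans (Nat.le_add_right _ _)
      exact (natDegree_sub_le _ _).trans (max_le (h.natDegree_X_mul_le (n + 1))
        (natDegree_add_le_of_degree_le
          (natDegree_add_le_of_degree_le (h.natDegree_eq _).le h1) h2))
    · rw [coeff_sub, coeff_add, coeff_add, coeff_X_mul, coeff_C_mul, coeff_C_mul, hz0, hz1,
        h.coeff_self, h.coeff_self]
      ring
    · intro k hk
      have e : (X * P (n + 1) - (P (n + 2) + C (diagCoeff u P (n + 1)) * P (n + 1) +
          C (subdiagCoeff u P (n + 1)) * P n)) * P k = P (n + 1) * (X * P k) - (P (n + 2) * P k +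
          C (diagCoeff u P (n + 1)) * (P (n + 1) * P k) +
          C (subdiagCoeff u P (n + 1)) * (P n * P k)) := by ring
      rw [e, map_sub, map_add, map_add, map_C_mul, map_C_mul, h.2.1 (n + 2) k (by omega)]
      rcases (by omega : k = n + 1 ∨ k = n ∨ k < n) with rfl | rfl | hk
      · rw [mul_left_comm, h.2.1 n (n + 1) (by omega), ← hb]
        ring
      · rw [h.mul_X_mul_succ, ← ha, h.2.1 (k + 1) k (by omega)]
        ring
      · rw [h.mul_X_mul_of_lt (by omega), h.2.1 (n + 1) k (by omega), h.2.1 n k (by omega)]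
        ring

end IsSMOP

/-- A nonzero polynomial times the product over its sign changes in `(a, b)` has constant sign. -/
theorem exists_finset_prod_dvd_constant_sign (a b : ℝ) (p : ℝ[X]) (hp : p ≠ 0) :
    ∃ s : Finset ℝ, (∀ r ∈ s, r ∈ Set.Ioo a b) ∧ (∏ r ∈ s, (X - C r)) ∣ p ∧
      ((∀ x ∈ Set.Ioo a b, 0 ≤ (p * ∏ r ∈ s, (X - C r)).eval x) ∨
        ∀ x ∈ Set.Ioo a b, (p * ∏ r ∈ s, (X - C r)).eval x ≤ 0) := by
  classical
  induction hn : p.natDegree generalizing p with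
  | zero =>
    refine ⟨∅, by simp, by simp, ?_⟩
    rw [natDegree_eq_zero] at hn
    obtain ⟨c, rfl⟩ := hn
    rcases le_total 0 c with hc | hc
    · left; intro x _; simpa using hc
    · right; intro x _; simpa using hc
  | succ n ih =>
    by_cases hroot : ∃ r ∈ Set.Ioo a b, p.IsRoot r
    · obtain ⟨r, hr, hpr⟩ := hroot
      obtain ⟨q, rfl⟩ := dvd_iff_isRoot.2 hpr
      have hq : q ≠ 0 := right_ne_zero_of_mul hp
      have hqn : q.natDegree = n := by
        rw [natDegree_mul (X_sub_C_ne_zero r) hq, natDegree_X_sub_C] at hn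
        omega
      obtain ⟨s, hs, hdvd, hsign⟩ := ih q hq hqn
      by_cases hrs : r ∈ s
      · refine ⟨s.erase r, fun t ht => hs t (Finset.mem_of_mem_erase ht), ?_, ?_⟩
        · exact ((Finset.prod_dvd_prod_of_subset _ _ _ (Finset.erase_subset r s)).trans
            hdvd).mul_left _
        · have e : (X - C r) * q * ∏ t ∈ s.erase r, (X - C t) = q * ∏ t ∈ s, (X - C t) := by
            rw [← Finset.mul_prod_erase s _ hrs]
            ring
          rwa [e]
      · refine ⟨insert r s, fun t ht => ?_, ?_, ?_⟩
        · rcases Finset.mem_insert.1 ht with rfl | ht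
          exacts [hr, hs t ht]
        · rw [Finset.prod_insert hrs]
          exact mul_dvd_mul_left _ hdvd
        · have e : ∀ x, ((X - C r) * q * ∏ t ∈ insert r s, (X - C t)).eval x
              = (x - r) ^ 2 * (q * ∏ t ∈ s, (X - C t)).eval x := by
            intro x
            rw [Finset.prod_insert hrs]
            simp only [eval_mul, eval_sub, eval_X, eval_C]
            ring
          simp only [e]
          exact hsign.imp (fun h x hx => mul_nonneg (sq_nonneg _) (h x hx))
            fun h x hx => mul_nonpos_of_nonneg_of_nonpos (sq_nonneg _) (h x hx)
    · refine ⟨∅, by simp, by simp, ?_⟩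
      simp only [Finset.prod_empty, mul_one]
      by_contra! hcon
      obtain ⟨⟨x, hx, hx0⟩, y, hy, hy0⟩ := hcon
      obtain ⟨c, hc, hc0⟩ := (isPreconnected_Ioo (a := a) (b := b)).intermediate_value hx hy
        p.continuous.continuousOn ⟨hx0.le, hy0.le⟩
      exact hroot ⟨c, hc, hc0⟩

/-- The zeros of the `n`-th orthogonal polynomial are real, simple and in `(a, b)`. -/
theorem IsSMOP.exists_zeros (h : IsSMOP u P) (hu : PositiveOn u a b) (n : ℕ) :
    ∃ x : Fin n → ℝ, StrictMono x ∧ (∀ k, x k ∈ Set.Ioo a b) ∧ P n = ∏ k, (X - C (x k)) := by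
  obtain ⟨s, hs, hdvd, hsign⟩ :=
    exists_finset_prod_dvd_constant_sign a b (P n) (h.monic n).ne_zero
  have hmon : (∏ r ∈ s, (X - C r)).Monic := monic_prod_X_sub_C _ _
  have hdeg : (∏ r ∈ s, (X - C r)).natDegree = s.card :=
    natDegree_finsetProd_X_sub_C_eq_card s id
  have hne : u (P n * ∏ r ∈ s, (X - C r)) ≠ 0 := by
    have h0 := mul_ne_zero (h.monic n).ne_zero hmon.ne_zero
    rcases hsign with hsign | hsign
    · exact (hu _ h0 hsign).ne'
    · have := hu _ (neg_ne_zero.2 h0) fun x hx => by rw [eval_neg]; linarith [hsign x hx]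
      rw [map_neg] at this
      linarith
  -- With fewer than `n` sign changes the product would have degree below `n` and be orthogonal to
  -- `P n`, against `hne`.
  have hcard : s.card = n := by
    refine le_antisymm ?_ (le_of_not_gt fun hlt => hne (h.mul_eq_zero_of_degree_lt ?_))
    · rw [← hdeg, ← h.natDegree_eq n]
      exact natDegree_le_of_dvd hdvd (h.monic n).ne_zero
    · rw [degree_eq_natDegree hmon.ne_zero, hdeg]
      exact_mod_cast hlt
  refine ⟨s.orderEmbOfFin hcard, (s.orderEmbOfFin hcard).strictMono,
    fun k => hs _ (s.orderEmbOfFin_mem hcard k), ?_⟩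
  have himg : ∏ r ∈ s, (X - C r) = ∏ r ∈ Finset.univ.image (s.orderEmbOfFin hcard), (X - C r) := by
    rw [Finset.image_orderEmbOfFin_univ]
  have heq := eq_of_monic_of_dvd_of_natDegree_le hmon (h.monic n) hdvd
    (by rw [h.natDegree_eq, hdeg, hcard])
  rw [heq, himg, Finset.prod_image fun _ _ _ _ => (s.orderEmbOfFin hcard).injective.eq_iff.1]

end Orthogonal

/-! ### Pearson equation, structure relation and differential equation. -/

/-- Integration by parts for `x^α e^{-x}` on `(0, z)`, with boundary term `κ p(z)`. -/
def HasBoundaryPearson (u : ℝ[X] →ₗ[ℝ] ℝ) (α z κ : ℝ) : Prop :=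
  ∀ p : ℝ[X], u (X * derivative p + (C (α + 1) - X) * p) = κ * p.eval z

/-- The polynomial `φ = x (z - x)` of the Pearson equation. -/
def pearsonφ (z : ℝ) : ℝ[X] := X * (C z - X)

/-- The polynomial `ψ = x² - (z + α + 2) x + (α + 1) z` of the Pearson equation. -/
def pearsonψ (α z : ℝ) : ℝ[X] := X * X - C (z + α + 2) * X + C ((α + 1) * z)

theorem natDegree_pearsonφ_mul_le {z : ℝ} {p : ℝ[X]} {n : ℕ} (hp : p.natDegree ≤ n) :
    (pearsonφ z * p).natDegree ≤ n + 2 := by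
  have : (pearsonφ z).natDegree ≤ 2 := by unfold pearsonφ; compute_degree
  rw [add_comm]
  exact natDegree_mul_le_of_le this hp

theorem natDegree_pearsonψ_mul_le {α z : ℝ} {p : ℝ[X]} {n : ℕ} (hp : p.natDegree ≤ n) :
    (pearsonψ α z * p).natDegree ≤ n + 2 := by
  have : (pearsonψ α z).natDegree ≤ 2 := by unfold pearsonψ; compute_degree
  rw [add_comm]
  exact natDegree_mul_le_of_le this hp

theorem coeff_pearsonφ_mul {z : ℝ} {p : ℝ[X]} {n : ℕ} (hp : p.natDegree ≤ n) :
    (pearsonφ z * p).coeff (n + 2) = -p.coeff n := by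
  have : p.coeff (n + 1) = 0 := coeff_eq_zero_of_natDegree_lt (by omega)
  rw [pearsonφ, mul_assoc, coeff_X_mul, sub_mul, coeff_sub, coeff_C_mul, coeff_X_mul, this]
  ring

theorem coeff_pearsonψ_mul {α z : ℝ} {p : ℝ[X]} {n : ℕ} (hp : p.natDegree ≤ n) :
    (pearsonψ α z * p).coeff (n + 2) = p.coeff n := by
  have h1 : p.coeff (n + 1) = 0 := coeff_eq_zero_of_natDegree_lt (by omega)
  have h2 : p.coeff (n + 2) = 0 := coeff_eq_zero_of_natDegree_lt (by omega)
  rw [pearsonψ, add_mul, sub_mul, mul_assoc, mul_assoc, coeff_add, coeff_sub, coeff_C_mul,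
    coeff_C_mul, coeff_X_mul, coeff_X_mul, coeff_X_mul, h1, h2]
  ring

/-- The differential operator `q ↦ φ q'' + ψ q'`, symmetric with respect to `u`. -/
def pearsonOp (α z : ℝ) (q : ℝ[X]) : ℝ[X] :=
  pearsonφ z * derivative (derivative q) + pearsonψ α z * derivative q

theorem natDegree_pearsonOp_le (α z : ℝ) {q : ℝ[X]} {n : ℕ} (hq : q.natDegree ≤ n) :
    (pearsonOp α z q).natDegree ≤ n + 1 := by
  rcases n with _ | _ | n
  · rw [eq_C_of_natDegree_le_zero hq]; simp [pearsonOp]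
  · have h1 : (derivative q).natDegree ≤ 0 := (natDegree_derivative_le _).trans (by omega)
    have h2 : derivative (derivative q) = 0 := by
      rw [eq_C_of_natDegree_le_zero h1, derivative_C]
    rw [pearsonOp, h2, mul_zero, zero_add]
    exact natDegree_pearsonψ_mul_le h1
  · have h1 : (derivative q).natDegree ≤ n + 1 := (natDegree_derivative_le _).trans (by omega)
    have h2 : (derivative (derivative q)).natDegree ≤ n :=
      (natDegree_derivative_le _).trans (by omega)
    exact natDegree_add_le_of_degree_le ((natDegree_pearsonφ_mul_le h2).trans (by omega))
      (natDegree_pearsonψ_mul_le h1)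

theorem coeff_pearsonOp (α z : ℝ) {q : ℝ[X]} {n : ℕ} (hq : q.natDegree ≤ n) :
    (pearsonOp α z q).coeff (n + 1) = n * q.coeff n := by
  rcases n with _ | _ | n
  · rw [eq_C_of_natDegree_le_zero hq]; simp [pearsonOp]
  · have h1 : (derivative q).natDegree ≤ 0 := (natDegree_derivative_le _).trans (by omega)
    have h2 : derivative (derivative q) = 0 := by
      rw [eq_C_of_natDegree_le_zero h1, derivative_C]
    rw [pearsonOp, h2, mul_zero, zero_add, coeff_pearsonψ_mul h1, coeff_derivative]
    push_cast; ring
  · have h1 : (derivative q).natDegree ≤ n + 1 := (natDegree_derivative_le _).trans (by omega)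
    have h2 : (derivative (derivative q)).natDegree ≤ n :=
      (natDegree_derivative_le _).trans (by omega)
    have h3 : (pearsonφ z * derivative (derivative q)).coeff (n + 1 + 2) = 0 :=
      coeff_eq_zero_of_natDegree_lt ((natDegree_pearsonφ_mul_le h2).trans_lt (by omega))
    rw [pearsonOp, coeff_add, coeff_pearsonψ_mul h1, h3, coeff_derivative]
    push_cast; ring

section Pearson

variable {u : ℝ[X] →ₗ[ℝ] ℝ} {P : ℕ → ℝ[X]} {α z κ : ℝ}

/-- The test function `(z - x) p` vanishes at `z`, so the boundary term disappears. -/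
theorem HasBoundaryPearson.pearson (hu : HasBoundaryPearson u α z κ) (p : ℝ[X]) :
    u (pearsonφ z * derivative p + pearsonψ α z * p) = 0 := by
  have h := hu ((C z - X) * p)
  rw [eval_mul, eval_sub, eval_C, eval_X, sub_self, zero_mul, mul_zero] at h
  rw [← h]
  congr 1
  simp only [pearsonφ, pearsonψ, derivative_mul, derivative_sub, derivative_C, derivative_X,
    map_add, map_mul, C_1, map_ofNat]
  ring

/-- The difference of the two sides is the Pearson identity for the Wronskian `p' q - p q'`. -/
theorem HasBoundaryPearson.pearsonOp_symm (hu : HasBoundaryPearson u α z κ) (p q : ℝ[X]) :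
    u (pearsonOp α z p * q) = u (p * pearsonOp α z q) := by
  rw [← sub_eq_zero, ← map_sub, ← hu.pearson (derivative p * q - p * derivative q)]
  congr 1
  simp only [pearsonOp, derivative_mul, derivative_sub]
  ring

variable {a b : ℝ}

theorem subdiagCoeff_mul (h : IsSMOP u P) (n : ℕ) :
    subdiagCoeff u P (n + 1) * u (P n * P n) = u (P (n + 1) * P (n + 1)) :=
  div_mul_cancel₀ _ (h.2.2 n)

theorem diagCoeff_mul (h : IsSMOP u P) (n : ℕ) :
    diagCoeff u P n * u (P n * P n) = u (X * (P n * P n)) :=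
  div_mul_cancel₀ _ (h.2.2 n)

/-- `φ P_n'' + ψ P_n'` in terms of `P_{n+1}, P_n, P_{n-1}`. -/
theorem exists_pearsonOp_eq (hu : HasBoundaryPearson u α z κ) (hpos : PositiveOn u a b)
    (h : IsSMOP u P) (n : ℕ) :
    ∃ s : ℝ, pearsonOp α z (P (n + 1)) = C (n + 1 : ℝ) * P (n + 2) + C s * P (n + 1) +
      C (n * subdiagCoeff u P (n + 1)) * P n := by
  -- The value of `s` is irrelevant: its term vanishes at the zeros of `P (n + 1)`.
  obtain ⟨s, hs⟩ : ∃ s, s * u (P (n + 1) * P (n + 1)) = u (pearsonOp α z (P (n + 1)) * P (n + 1)) :=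
    ⟨_, div_mul_cancel₀ _ (h.2.2 _)⟩
  refine ⟨s, sub_eq_zero.1 (h.eq_zero_of_natDegree_le hpos (n := n + 2) ?_ ?_ fun k hk => ?_)⟩
  · have h1 : (C s * P (n + 1)).natDegree ≤ n + 2 :=
      (natDegree_C_mul_le _ _).trans ((h.natDegree_eq _).trans_le (Nat.le_succ _))
    have h2 : (C (n * subdiagCoeff u P (n + 1)) * P n).natDegree ≤ n + 2 :=
      (natDegree_C_mul_le _ _).trans ((h.natDegree_eq _).trans_le (Nat.le_add_right _ _))
    have h3 : (C (n + 1 : ℝ) * P (n + 2)).natDegree ≤ n + 2 :=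
      (natDegree_C_mul_le _ _).trans (h.natDegree_eq _).le
    exact (natDegree_sub_le _ _).trans (max_le (natDegree_pearsonOp_le α z (h.natDegree_eq _).le)
      (natDegree_add_le_of_degree_le (natDegree_add_le_of_degree_le h3 h1) h2))
  · have hz1 : (P (n + 1)).coeff (n + 2) = 0 :=
      coeff_eq_zero_of_natDegree_lt (by rw [h.natDegree_eq]; omega)
    have hz0 : (P n).coeff (n + 2) = 0 :=
      coeff_eq_zero_of_natDegree_lt (by rw [h.natDegree_eq]; omega)
    rw [coeff_sub, coeff_add, coeff_add, coeff_C_mul, coeff_C_mul, coeff_C_mul, hz0, hz1,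
      coeff_pearsonOp α z (h.natDegree_eq _).le, h.coeff_self, h.coeff_self]
    push_cast
    ring
  · rw [sub_mul, add_mul, add_mul, mul_assoc, mul_assoc, mul_assoc, map_sub, map_add, map_add,
      map_C_mul, map_C_mul, map_C_mul, h.2.1 (n + 2) k (by omega)]
    rcases (by omega : k = n + 1 ∨ k = n ∨ k < n) with rfl | rfl | hk
    · rw [h.2.1 n (n + 1) (by omega), hs]
      ring
    -- By symmetry the operator acts on `P k`, giving degree at most `k + 1`, so only the top
    -- coefficient `k` survives.
    · rw [hu.pearsonOp_symm, h.mul_eq_coeff_mul (natDegree_pearsonOp_le α z (h.natDegree_eq _).le),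
        coeff_pearsonOp α z (h.natDegree_eq _).le, h.coeff_self, h.2.1 (k + 1) k (by omega),
        ← subdiagCoeff_mul h]
      ring
    · have hd : (pearsonOp α z (P k)).natDegree < n + 1 :=
        (natDegree_pearsonOp_le α z (h.natDegree_eq k).le).trans_lt (by omega)
      rw [hu.pearsonOp_symm, h.mul_eq_zero_of_degree_lt
        (degree_le_natDegree.trans_lt (Nat.cast_lt.2 hd)), h.2.1 (n + 1) k (by omega),
        h.2.1 n k (by omega)]
      ring

/-- The structure relation: `φ P_n'` in terms of `P_{n+1}, P_n, P_{n-1}`. -/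
theorem exists_pearsonφ_mul_derivative_eq (hu : HasBoundaryPearson u α z κ)
    (hpos : PositiveOn u a b) (h : IsSMOP u P) (n : ℕ) :
    ∃ s : ℝ, pearsonφ z * derivative (P (n + 1)) = C s * P (n + 1) - C (n + 1 : ℝ) * P (n + 2) -
      C (subdiagCoeff u P (n + 1)) *
        (X - C (n + 2 + α + z - diagCoeff u P (n + 1))) * P n := by
  -- The term `X * P n` supplies the `P_{n-1}` component, and `c` is then forced by testing against
  -- `P n`. What `X * P n` adds along `P (n + 1)` is absorbed into `s`.
  set c : ℝ := n + 2 + α + z - diagCoeff u P (n + 1) with hc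
  set A := subdiagCoeff u P (n + 1) with hA
  obtain ⟨s, hs⟩ : ∃ s, s * u (P (n + 1) * P (n + 1)) =
      u (pearsonφ z * derivative (P (n + 1)) * P (n + 1)) + A * u ((X - C c) * P n * P (n + 1)) :=
    ⟨_, div_mul_cancel₀ _ (h.2.2 _)⟩
  have hd' : ∀ k, (derivative (P (k + 1))).natDegree ≤ k := fun k =>
    (natDegree_derivative_le _).trans (by rw [h.natDegree_eq]; rfl)
  have hparts : ∀ k, u (pearsonφ z * derivative (P (n + 1)) * P k) =
      -u (P (n + 1) * (pearsonφ z * derivative (P k))) - u (P (n + 1) * (pearsonψ α z * P k)) := by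
    intro k
    rw [eq_sub_iff_add_eq, eq_neg_iff_add_eq_zero, ← map_add, ← map_add,
      ← hu.pearson (P (n + 1) * P k), derivative_mul]
    congr 1
    ring
  have hφ : ∀ k, (pearsonφ z * derivative (P k)).natDegree ≤ k + 1 ∧
      (pearsonφ z * derivative (P k)).coeff (k + 1) = -k := by
    intro k
    rcases k with _ | k
    · simp [h.zero_eq_one]
    · refine ⟨natDegree_pearsonφ_mul_le (hd' k), ?_⟩
      rw [coeff_pearsonφ_mul (hd' k), coeff_derivative, h.coeff_self]
      push_cast
      ring
  refine ⟨s, sub_eq_zero.1 (h.eq_zero_of_natDegree_le hpos (n := n + 2) ?_ ?_ fun k hk => ?_)⟩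
  · have h1 : (C s * P (n + 1)).natDegree ≤ n + 2 :=
      (natDegree_C_mul_le _ _).trans ((h.natDegree_eq _).trans_le (Nat.le_succ _))
    have h2 : (C A * (X - C c) * P n).natDegree ≤ n + 2 := by
      rw [mul_assoc]
      refine (natDegree_C_mul_le _ _).trans ?_
      rw [(monic_X_sub_C c).natDegree_mul (h.monic n), natDegree_X_sub_C, h.natDegree_eq]
      omega
    have h3 : (C (n + 1 : ℝ) * P (n + 2)).natDegree ≤ n + 2 :=
      (natDegree_C_mul_le _ _).trans (h.natDegree_eq _).le
    exact (natDegree_sub_le _ _).trans (max_le (hφ (n + 1)).1 ((natDegree_sub_le _ _).trans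
      (max_le ((natDegree_sub_le _ _).trans (max_le h1 h3)) h2)))
  · have hz1 : (P (n + 1)).coeff (n + 2) = 0 :=
      coeff_eq_zero_of_natDegree_lt (by rw [h.natDegree_eq]; omega)
    have hz0 : ((X - C c) * P n).coeff (n + 2) = 0 := by
      refine coeff_eq_zero_of_natDegree_lt ?_
      rw [(monic_X_sub_C c).natDegree_mul (h.monic n), natDegree_X_sub_C, h.natDegree_eq]
      omega
    rw [mul_assoc, coeff_sub, coeff_sub, coeff_sub, coeff_C_mul, coeff_C_mul, coeff_C_mul, hz0, hz1,
      (hφ (n + 1)).2, h.coeff_self]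
    push_cast
    ring
  · rw [sub_mul, sub_mul, sub_mul, mul_assoc (C _), mul_assoc (C _), mul_assoc (C _),
      mul_assoc (C _), map_sub, map_sub, map_sub, map_C_mul, map_C_mul, map_C_mul,
      h.2.1 (n + 2) k (by omega)]
    rcases (by omega : k = n + 1 ∨ k = n ∨ k < n) with rfl | rfl | hk
    · rw [hs]
      ring
    · have hX : u (P (k + 1) * (pearsonψ α z * P k)) =
          (diagCoeff u P (k + 1) + diagCoeff u P k - (z + α + 2)) *
            u (P (k + 1) * P (k + 1)) := by
        have e : P (k + 1) * (pearsonψ α z * P k) = (X * P (k + 1)) * (X * P k) -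
            C (z + α + 2) * (P (k + 1) * (X * P k)) + C ((α + 1) * z) * (P (k + 1) * P k) := by
          rw [pearsonψ]
          ring
        rw [e, (h.hasThreeTermRecurrence hpos).2.2 k, add_mul, add_mul, mul_assoc, mul_assoc,
          map_add, map_sub, map_add, map_add, map_C_mul, map_C_mul, map_C_mul, map_C_mul,
          h.mul_X_mul_of_lt (by omega : k + 1 < k + 2), h.mul_X_mul_succ,
          h.2.1 (k + 1) k (by omega), mul_left_comm (P k), ← diagCoeff_mul h k,
          ← subdiagCoeff_mul h k]
        ring
      have hc' : u ((X - C c) * P k * P k) = (diagCoeff u P k - c) * u (P k * P k) := by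
        rw [mul_assoc, sub_mul, map_sub, map_C_mul, ← diagCoeff_mul h k]
        ring
      rw [hparts, h.mul_eq_coeff_mul (hφ k).1, (hφ k).2, h.2.1 (k + 1) k (by omega), hX,
        hc', ← subdiagCoeff_mul h k]
      ring
    · obtain ⟨m, rfl⟩ : ∃ m, n = m + 1 := ⟨n - 1, by omega⟩
      have h0 : u (P (m + 2) * (pearsonφ z * derivative (P k))) = 0 :=
        h.mul_eq_zero_of_degree_lt (degree_le_natDegree.trans_lt
          (Nat.cast_lt.2 ((hφ k).1.trans_lt (by omega))))
      have hkm : (P k).natDegree ≤ m := (h.natDegree_eq k).trans_le (by omega)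
      have h1 : ((X - C c) * P k).natDegree ≤ m + 1 := by
        rw [(monic_X_sub_C c).natDegree_mul (h.monic k), natDegree_X_sub_C]
        omega
      have h2 : (P k).coeff (m + 1) = 0 := coeff_eq_zero_of_natDegree_lt (by omega)
      rw [hparts, h0, h.mul_eq_coeff_mul (natDegree_pearsonψ_mul_le hkm), coeff_pearsonψ_mul hkm,
        h.2.1 (m + 1 + 1) k (by omega), mul_right_comm, mul_comm _ (P (m + 1)),
        h.mul_eq_coeff_mul h1, sub_mul, coeff_sub, coeff_X_mul, coeff_C_mul, h2,
        ← subdiagCoeff_mul h (m + 1)]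
      ring

/-- The differential equation of the orthogonal polynomials, at their zeros. -/
theorem pearsonφ_mul_derivative_eval_eq (hu : HasBoundaryPearson u α z κ)
    (hpos : PositiveOn u a b) (h : IsSMOP u P) (n : ℕ) {x : ℝ} (hx : (P (n + 1)).eval x = 0) :
    (pearsonφ z).eval x * (derivative (P (n + 1))).eval x =
      (x - (-diagCoeff u P (n + 1) + (2 * n + α + z + 3))) *
        (pearsonOp α z (P (n + 1))).eval x := by
  obtain ⟨s, hs⟩ := exists_pearsonOp_eq hu hpos h n
  obtain ⟨t, ht⟩ := exists_pearsonφ_mul_derivative_eq hu hpos h n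
  have hr := congrArg (eval x) ((h.hasThreeTermRecurrence hpos).2.2 n)
  simp only [eval_mul, eval_add, eval_X, eval_C, hx] at hr
  rw [← eval_mul, ht, hs]
  simp only [eval_mul, eval_add, eval_sub, eval_X, eval_C, hx]
  -- Both sides become multiples of `a_{n+1} P_n(x)`, with factors `-(x - c - (n + 1))` and `-1`;
  -- hence `β = c + n + 1`.
  have h2 : (P (n + 2)).eval x = -(subdiagCoeff u P (n + 1) * (P n).eval x) := by linarith
  rw [h2]
  ring

/-- Integration by parts with `p = P_n²` gives `(2n + α + 1 - b_n) ⟨u, P_n²⟩ = κ P_n(z)²`, and the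
right side is positive. -/
theorem diagCoeff_lt (hu : HasBoundaryPearson u α z κ) (hκ : 0 < κ) (hpos : PositiveOn u a b)
    (h : IsSMOP u P) {n : ℕ} (hz : (P n).eval z ≠ 0) : diagCoeff u P n < 2 * n + α + 1 := by
  have hh := hpos.mul_self_pos (h.monic n).ne_zero
  have hd : u (P n * (X * derivative (P n))) = n * u (P n * P n) := by
    rcases n with _ | n
    · simp [h.zero_eq_one]
    · rw [h.mul_eq_coeff_mul, coeff_X_mul, coeff_derivative, h.coeff_self]
      · push_cast; ring
      · refine (natDegree_mul_le_of_le natDegree_X_le (natDegree_derivative_le _)).trans ?_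
        rw [h.natDegree_eq]
        omega
  have key := hu (P n * P n)
  have e : X * derivative (P n * P n) + (C (α + 1) - X) * (P n * P n) =
      C 2 * (P n * (X * derivative (P n))) + C (α + 1) * (P n * P n) - X * (P n * P n) := by
    rw [derivative_mul, map_ofNat]
    ring
  rw [e, map_sub, map_add, map_C_mul, map_C_mul, hd, ← diagCoeff_mul h, eval_mul] at key
  have : 0 < κ * ((P n).eval z * (P n).eval z) := mul_pos hκ (mul_self_pos.2 hz)
  rw [← key] at this
  nlinarith

end Pearson

/-! ### Energy derivatives, the differential criterion and uniqueness. -/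

section Energy

theorem hasDerivAt_log_one_div_abs_sub {c x : ℝ} (hx : x ≠ c) :
    HasDerivAt (fun t => Real.log (1 / |t - c|)) (-(1 / (x - c))) x := by
  have h : (fun t : ℝ => Real.log (1 / |t - c|)) = fun t => -Real.log (t - c) := by
    funext t
    rw [one_div, Real.log_inv, Real.log_abs]
  rw [h]
  exact (((hasDerivAt_id x).sub_const c).log (sub_ne_zero.2 hx)).neg

theorem hasDerivAt_update_apply {N : ℕ} (x : Fin N → ℝ) (k j : Fin N) :
    HasDerivAt (fun t => Function.update x k t j) (if j = k then 1 else 0) (x k) := by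
  by_cases h : j = k
  · subst h
    simpa using hasDerivAt_id' (x j)
  · simpa [h] using hasDerivAt_const (x k) (x j)

/-- Only pairs containing `k` contribute. Those where `k` is the larger index enter with a minus
sign, which the reversed denominator cancels. -/
theorem sum_sum_Ioi_ite {N : ℕ} (x : Fin N → ℝ) (k : Fin N) :
    ∑ j : Fin N, ∑ l ∈ Finset.Ioi j,
      ((if j = k then (1 : ℝ) else 0) - if l = k then 1 else 0) / (x j - x l) =
      ∑ j ∈ Finset.univ.erase k, 1 / (x k - x j) := by
  have h1 : ∑ j : Fin N, ∑ l ∈ Finset.Ioi j, (if j = k then (1 : ℝ) else 0) / (x j - x l) =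
      ∑ l ∈ Finset.Ioi k, 1 / (x k - x l) := by
    rw [Finset.sum_eq_single k (fun j _ hj => by simp [hj]) (by simp)]
    simp
  have h2 : ∑ j : Fin N, ∑ l ∈ Finset.Ioi j, (if l = k then (1 : ℝ) else 0) / (x j - x l) =
      -∑ j ∈ Finset.Iio k, 1 / (x k - x j) := by
    rw [Finset.sum_comm' (t' := Finset.univ) (s' := fun l => Finset.Iio l) (by simp),
      Finset.sum_eq_single k (fun j _ hj => by simp [hj]) (by simp), ← Finset.sum_neg_distrib]
    refine Finset.sum_congr rfl fun j _ => ?_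
    rw [if_pos rfl, ← neg_sub (x k), div_neg]
  have h3 : Finset.univ.erase k = Finset.Ioi k ∪ Finset.Iio k := by
    ext j
    simp only [Finset.mem_erase, Finset.mem_univ, and_true, Finset.mem_union, Finset.mem_Ioi,
      Finset.mem_Iio]
    exact ⟨fun h => (lt_or_gt_of_ne h).symm, fun h => h.elim ne_of_gt ne_of_lt⟩
  have h4 : Disjoint (Finset.Ioi k) (Finset.Iio k) :=
    Finset.disjoint_left.2 fun j h h' =>
      lt_asymm (Finset.mem_Ioi.1 h) (Finset.mem_Iio.1 h')
  simp only [sub_div, Finset.sum_sub_distrib]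
  rw [h1, h2, h3, Finset.sum_union h4]
  ring

theorem hasDerivAt_energy {V : ℝ → ℝ} {N : ℕ} {x : Fin N → ℝ} (hx : Function.Injective x)
    {k : Fin N} {V' : ℝ} (hV : HasDerivAt V V' (x k)) :
    HasDerivAt (fun t => energy V (Function.update x k t))
      (-2 * ∑ j ∈ Finset.univ.erase k, 1 / (x k - x j) + V') (x k) := by
  have hpair : ∀ j : Fin N, ∀ l ∈ Finset.Ioi j,
      HasDerivAt (fun t => Real.log (1 / |Function.update x k t j - Function.update x k t l|))
        (-(((if j = k then (1 : ℝ) else 0) - if l = k then 1 else 0) / (x j - x l))) (x k) := by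
    intro j l hl
    have hne : x j ≠ x l := fun h => (Finset.mem_Ioi.1 hl).ne (hx h)
    have hf : (fun t => Real.log (1 / |Function.update x k t j - Function.update x k t l|)) =
        fun t => -Real.log (Function.update x k t j - Function.update x k t l) := by
      funext t
      rw [one_div, Real.log_inv, Real.log_abs]
    rw [hf]
    have := (((hasDerivAt_update_apply x k j).fun_sub (hasDerivAt_update_apply x k l)).log
      (by simpa using sub_ne_zero.2 hne)).fun_neg
    simpa using this
  have hext : ∀ j : Fin N, HasDerivAt (fun t => V (Function.update x k t j))
      (if j = k then V' else 0) (x k) := by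
    intro j
    by_cases h : j = k
    · subst h
      simpa using hV
    · simpa [h] using hasDerivAt_const (x k) (V (x j))
  have := ((HasDerivAt.fun_sum fun j (_ : j ∈ Finset.univ) =>
    HasDerivAt.fun_sum (hpair j)).const_mul 2).add
      (HasDerivAt.fun_sum fun j (_ : j ∈ Finset.univ) => hext j)
  refine this.congr_deriv ?_
  simp only [Finset.sum_neg_distrib, sum_sum_Ioi_ite]
  simp

theorem inEquilibriumAt_iff {V : ℝ → ℝ} {N : ℕ} {x : Fin N → ℝ} (hx : Function.Injective x)
    {k : Fin N} {V' : ℝ} (hV : HasDerivAt V V' (x k)) :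
    InEquilibriumAt V x k ↔ V' = 2 * ∑ j ∈ Finset.univ.erase k, 1 / (x k - x j) := by
  have h := hasDerivAt_energy hx hV
  constructor
  · intro h0
    have := h0.unique h
    linarith
  · intro h0
    refine h.congr_deriv ?_
    rw [h0]
    ring

theorem derivative_prod_X_sub_C_eval {N : ℕ} {x : Fin N → ℝ} (k : Fin N) :
    (derivative (∏ j, (X - C (x j)))).eval (x k) = ∏ j ∈ Finset.univ.erase k, (x k - x j) := by
  rw [← Finset.mul_prod_erase Finset.univ _ (Finset.mem_univ k), derivative_mul]
  simp [eval_prod]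

/-- Writing `p = (X - x_k) q` gives `p'(x_k) = q(x_k)` and `p''(x_k) = 2 q'(x_k)`; the sum is the
logarithmic derivative of `q`. -/
theorem derivative_derivative_prod_X_sub_C_eval {N : ℕ} {x : Fin N → ℝ}
    (hx : Function.Injective x) (k : Fin N) :
    (derivative (derivative (∏ j, (X - C (x j))))).eval (x k) =
      2 * (∑ j ∈ Finset.univ.erase k, 1 / (x k - x j)) *
        (derivative (∏ j, (X - C (x j)))).eval (x k) := by
  have h : ∀ q : ℝ[X], (derivative (derivative ((X - C (x k)) * q))).eval (x k) =
      2 * (derivative q).eval (x k) := by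
    intro q
    simp only [derivative_mul, derivative_sub, derivative_X, derivative_C, derivative_add,
      derivative_one, derivative_zero, eval_add, eval_mul, eval_sub, eval_X, eval_C, eval_one,
      eval_zero]
    simp
    ring
  rw [derivative_prod_X_sub_C_eval, ← Finset.mul_prod_erase Finset.univ _ (Finset.mem_univ k), h,
    derivative_prod_finset, eval_finsetSum, mul_assoc, Finset.sum_mul]
  congr 1
  refine Finset.sum_congr rfl fun j hj => ?_
  have hne : x k - x j ≠ 0 := sub_ne_zero.2 fun e => (Finset.ne_of_mem_erase hj) (hx e).symm
  rw [← Finset.mul_prod_erase _ (fun i => x k - x i) hj]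
  simp only [derivative_sub, derivative_X, derivative_C, sub_zero, mul_one, eval_prod, eval_sub,
    eval_X, eval_C]
  field_simp

theorem derivative_prod_X_sub_C_eval_ne_zero {N : ℕ} {x : Fin N → ℝ}
    (hx : Function.Injective x) (k : Fin N) :
    (derivative (∏ j, (X - C (x j)))).eval (x k) ≠ 0 := by
  rw [derivative_prod_X_sub_C_eval]
  exact Finset.prod_ne_zero_iff.2 fun j hj =>
    sub_ne_zero.2 fun e => (Finset.ne_of_mem_erase hj) (hx e).symm

/-- Equilibrium at the zeros of `p` is the differential relation `p'' = V' p'`. -/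
theorem inEquilibriumAt_iff_derivative {V : ℝ → ℝ} {N : ℕ} {x : Fin N → ℝ}
    (hx : Function.Injective x) {p : ℝ[X]} (hp : p = ∏ j, (X - C (x j))) {k : Fin N} {V' : ℝ}
    (hV : HasDerivAt V V' (x k)) :
    InEquilibriumAt V x k ↔
      (derivative (derivative p)).eval (x k) = V' * (derivative p).eval (x k) := by
  rw [inEquilibriumAt_iff hx hV, hp, derivative_derivative_prod_X_sub_C_eval hx,
    mul_left_inj' (derivative_prod_X_sub_C_eval_ne_zero hx k), eq_comm]

/-- In a field with strictly increasing derivative there is at most one ordered equilibrium. -/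
theorem equilibrium_unique {V V' : ℝ → ℝ} {s : Set ℝ} (hV : ∀ x ∈ s, HasDerivAt V (V' x) x)
    (hmono : StrictMonoOn V' s) {N : ℕ} {x y : Fin N → ℝ} (hx : StrictMono x) (hy : StrictMono y)
    (hxs : ∀ k, x k ∈ s) (hys : ∀ k, y k ∈ s) (hxe : ∀ k, InEquilibriumAt V x k)
    (hye : ∀ k, InEquilibriumAt V y k) : x = y := by
  have hx' := fun k => (inEquilibriumAt_iff hx.injective (hV _ (hxs k))).1 (hxe k)
  have hy' := fun k => (inEquilibriumAt_iff hy.injective (hV _ (hys k))).1 (hye k)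
  -- The difference between the pair forces of the two configurations; it is antisymmetric in `k`
  -- and `j`.
  set f : Fin N → Fin N → ℝ := fun k j =>
    if j = k then 0 else 1 / (x k - x j) - 1 / (y k - y j) with hf
  have hanti : ∀ k j, f k j = -f j k := by
    intro k j
    by_cases h : j = k
    · simp [hf, h]
    · simp only [hf, if_neg h, if_neg (Ne.symm h)]
      rw [← neg_sub (x j), ← neg_sub (y j), one_div_neg_eq_neg_one_div, one_div_neg_eq_neg_one_div]
      ring
  have hrow : ∀ k, V' (x k) - V' (y k) = 2 * ∑ j, f k j := by
    intro k
    rw [hx' k, hy' k, ← Finset.add_sum_erase _ _ (Finset.mem_univ k), ← mul_sub,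
      ← Finset.sum_sub_distrib]
    simp only [hf, if_true, zero_add]
    congr 1
    exact Finset.sum_congr rfl fun j hj => by rw [if_neg (Finset.ne_of_mem_erase hj)]
  -- Both configurations are ordered alike, so the gaps have the same sign, and there the reciprocal
  -- is decreasing.
  have hterm : ∀ k j, ((x k - y k) - (x j - y j)) * f k j ≤ 0 := by
    have hpos : ∀ p q : ℝ, 0 < p → 0 < q → (p - q) * (1 / p - 1 / q) ≤ 0 := by
      intro p q hp hq
      have : (p - q) * (1 / p - 1 / q) = -((p - q) ^ 2 / (p * q)) := by
        field_simp
        ring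
      rw [this]
      exact neg_nonpos.2 (by positivity)
    have hlt : ∀ k j, j < k → ((x k - y k) - (x j - y j)) * f k j ≤ 0 := by
      intro k j hjk
      have := hpos _ _ (sub_pos.2 (hx hjk)) (sub_pos.2 (hy hjk))
      simp only [hf, if_neg hjk.ne]
      linarith
    intro k j
    rcases lt_trichotomy j k with h | h | h
    · exact hlt k j h
    · simp [hf, h]
    · have := hlt j k h
      rw [hanti k j]
      linarith
  -- Antisymmetry turns the sum into one over pairs, each term nonpositive. Strict monotonicity of
  -- `V'` makes it positive unless `x = y`.
  have hsum : ∑ k, (x k - y k) * (V' (x k) - V' (y k)) ≤ 0 := by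
    have h1 : ∑ k, (x k - y k) * (V' (x k) - V' (y k)) =
        ∑ k, ∑ j, ((x k - y k) - (x j - y j)) * f k j := by
      simp only [sub_mul (_ - _), Finset.sum_sub_distrib]
      rw [Finset.sum_comm (f := fun k j => (x j - y j) * f k j)]
      have h2 : ∀ k j, (x j - y j) * f k j = -((x j - y j) * f j k) := fun k j => by
        rw [hanti k j]; ring
      simp only [h2, Finset.sum_neg_distrib, hrow, ← Finset.mul_sum]
      rw [sub_neg_eq_add, ← Finset.sum_add_distrib]
      exact Finset.sum_congr rfl fun k _ => by ring
    rw [h1]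
    exact Finset.sum_nonpos fun k _ => Finset.sum_nonpos fun j _ => hterm k j
  have hnn : ∀ k, x k ≠ y k → 0 < (x k - y k) * (V' (x k) - V' (y k)) := by
    intro k hk
    rcases lt_or_gt_of_ne hk with h | h
    · exact mul_pos_of_neg_of_neg (sub_neg.2 h) (sub_neg.2 (hmono (hxs k) (hys k) h))
    · exact mul_pos (sub_pos.2 h) (sub_pos.2 (hmono (hys k) (hxs k) h))
  have hnn' : ∀ k, 0 ≤ (x k - y k) * (V' (x k) - V' (y k)) := by
    intro k
    by_cases hk : x k = y k
    · rw [hk, sub_self, zero_mul]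
    · exact (hnn k hk).le
  funext k
  by_contra hk
  have := Finset.sum_pos' (fun k _ => hnn' k) ⟨k, Finset.mem_univ k, hnn k hk⟩
  linarith

end Energy

open MeasureTheory

/-! ### The two weights and the quadratic substitution between them. -/

section Functionals

/-- Integration of polynomials against an integrable weight. -/
def weightFunctional (w : ℝ → ℝ) (a b : ℝ) (hw : IntervalIntegrable w volume a b) :
    ℝ[X] →ₗ[ℝ] ℝ where
  toFun p := ∫ x in a..b, p.eval x * w x
  map_add' p q := by
    simp only [eval_add, add_mul]
    exact intervalIntegral.integral_add (hw.continuousOn_mul p.continuousOn)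
      (hw.continuousOn_mul q.continuousOn)
  map_smul' c p := by
    simp only [eval_smul, smul_eq_mul, mul_assoc, RingHom.id_apply]
    exact intervalIntegral.integral_const_mul _ _

/-- The integrand is positive off the finitely many roots of `p` and the origin. The origin is
exempt because `|x|^{2α+1}` may vanish there. -/
theorem positiveOn_weightFunctional {w : ℝ → ℝ} {a b : ℝ} (hab : a < b)
    (hw : IntervalIntegrable w volume a b) (hnn : ∀ x ∈ Set.Ioo a b, 0 ≤ w x)
    (hpos : ∀ x ∈ Set.Ioo a b, x ≠ 0 → 0 < w x) :
    PositiveOn (weightFunctional w a b hw) a b := by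
  intro p hp hp0
  refine (intervalIntegral.integral_pos_iff_support_of_nonneg_ae' ?_
    (hw.continuousOn_mul p.continuousOn)).2 ⟨hab, ?_⟩
  · rw [Set.uIoc_of_le hab.le]
    refine ae_restrict_of_ae_eq_of_ae_restrict Ioo_ae_eq_Ioc ?_
    refine (ae_restrict_iff' measurableSet_Ioo).2 (Filter.Eventually.of_forall fun x hx => ?_)
    exact mul_nonneg (hp0 x hx) (hnn x hx)
  · have hsub : Set.Ioo a b \ ((p.roots.toFinset : Set ℝ) ∪ {0}) ⊆
        (Function.support fun x => p.eval x * w x) ∩ Set.Ioc a b := by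
      rintro x ⟨hx, hx0⟩
      simp only [Set.mem_union, Finset.mem_coe, Multiset.mem_toFinset, mem_roots hp,
        Set.mem_singleton_iff, not_or] at hx0
      exact ⟨mul_ne_zero hx0.1 (hpos x hx hx0.2).ne', Set.Ioo_subset_Ioc_self hx⟩
    refine lt_of_lt_of_le ?_ (measure_mono hsub)
    rw [measure_sdiff_null ((p.roots.toFinset.finite_toSet.union (Set.finite_singleton 0)).measure_zero
      volume), Real.volume_Ioo]
    simpa using hab

theorem intervalIntegrable_laguerreWeight {α : ℝ} (hα : -1 < α) (a b : ℝ) :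
    IntervalIntegrable (fun x => x ^ α * Real.exp (-x)) volume a b :=
  (intervalIntegral.intervalIntegrable_rpow' hα).mul_continuousOn (by fun_prop)

theorem intervalIntegrable_hermiteWeight {α : ℝ} (hα : -1 < α) (a b : ℝ) :
    IntervalIntegrable (fun x => |x| ^ (2 * α + 1) * Real.exp (-x ^ 2)) volume a b := by
  refine IntervalIntegrable.mul_continuousOn ?_ (by fun_prop)
  refine intervalIntegrable_of_even (fun x => by rw [abs_neg]) fun x hx => ?_
  refine (intervalIntegral.intervalIntegrable_rpow' (by linarith : -1 < 2 * α + 1)).congr ?_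
  intro t ht
  rw [Set.uIoc_of_le hx.le] at ht
  simp only [abs_of_pos ht.1]

/-- The truncated Laguerre functional as a linear map. -/
def laguerreLin {α : ℝ} (hα : -1 < α) (z : ℝ) : ℝ[X] →ₗ[ℝ] ℝ :=
  weightFunctional _ 0 z (intervalIntegrable_laguerreWeight hα 0 z)

/-- The truncated generalized Hermite functional as a linear map. -/
def hermiteLin {α : ℝ} (hα : -1 < α) (z : ℝ) : ℝ[X] →ₗ[ℝ] ℝ :=
  weightFunctional _ (-√z) (√z) (intervalIntegrable_hermiteWeight hα (-√z) (√z))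

variable {α z : ℝ}

theorem coe_laguerreLin (hα : -1 < α) (z : ℝ) : ⇑(laguerreLin hα z) = laguerreFunctional α z := by
  funext p
  simp only [laguerreFunctional, mul_assoc]
  rfl

theorem coe_hermiteLin (hα : -1 < α) (z : ℝ) : ⇑(hermiteLin hα z) = hermiteFunctional α z := by
  funext p
  simp only [hermiteFunctional, mul_assoc]
  rfl

theorem positiveOn_laguerreLin (hα : -1 < α) (hz : 0 < z) :
    PositiveOn (laguerreLin hα z) 0 z :=
  positiveOn_weightFunctional hz _
    (fun _ hx => mul_nonneg (Real.rpow_nonneg hx.1.le _) (Real.exp_pos _).le)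
    fun _ hx _ => mul_pos (Real.rpow_pos_of_pos hx.1 _) (Real.exp_pos _)

theorem positiveOn_hermiteLin (hα : -1 < α) (hz : 0 < z) :
    PositiveOn (hermiteLin hα z) (-√z) (√z) :=
  positiveOn_weightFunctional (by have := Real.sqrt_pos.2 hz; linarith) _
    (fun _ _ => by positivity)
    fun _ _ hx => mul_pos (Real.rpow_pos_of_pos (abs_pos.2 hx) _) (Real.exp_pos _)

/-- The integrand is the derivative of `p(x) x^{α+1} e^{-x}`, which vanishes at `0` because `α + 1 >
0`. -/
theorem hasBoundaryPearson_laguerreLin (hα : -1 < α) (hz : 0 < z) :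
    HasBoundaryPearson (laguerreLin hα z) α z (z ^ (α + 1) * Real.exp (-z)) := by
  intro p
  have hint := (intervalIntegrable_laguerreWeight hα 0 z).continuousOn_mul
    (X * derivative p + (C (α + 1) - X) * p).continuousOn
  have hftc := intervalIntegral.integral_eq_sub_of_hasDerivAt_of_le hz.le
    (f := fun x => p.eval x * (x ^ (α + 1) * Real.exp (-x))) ?_ ?_ hint
  · refine hftc.trans ?_
    rw [Real.zero_rpow (by linarith)]
    ring
  · refine p.continuousOn.mul (ContinuousOn.mul ?_ (by fun_prop))
    exact continuousOn_id.rpow_const fun x _ => Or.inr (by linarith)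
  · intro x hx
    have h1 := Real.hasDerivAt_rpow_const (p := α + 1) (Or.inl hx.1.ne')
    have h2 := (hasDerivAt_neg x).exp
    refine ((p.hasDerivAt x).mul (h1.mul h2)).congr_deriv ?_
    rw [add_sub_cancel_right]
    simp only [eval_add, eval_mul, eval_sub, eval_X, eval_C, Pi.mul_apply]
    rw [Real.rpow_add_one hx.1.ne']
    ring

theorem laguerreFunctional_X_mul (hz : 0 < z) (p : ℝ[X]) :
    laguerreFunctional α z (X * p) = laguerreFunctional (α + 1) z p := by
  refine intervalIntegral.integral_congr_ae (Filter.Eventually.of_forall fun x hx => ?_)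
  rw [Set.uIoc_of_le hz.le] at hx
  rw [Real.rpow_add_one hx.1.ne', eval_mul, eval_X]
  ring

theorem polyQ_eq (hz : 0 < z) : polyQ α z = polyP (α + 1) z := by
  funext n
  unfold polyQ polyP
  simp only [laguerreFunctional_X_mul hz]

theorem hermiteFunctional_comp_neg (p : ℝ[X]) :
    hermiteFunctional α z (p.comp (-X)) = hermiteFunctional α z p := by
  unfold hermiteFunctional
  have h := intervalIntegral.integral_comp_neg (a := -√z) (b := √z)
    fun x : ℝ => p.eval x * |x| ^ (2 * α + 1) * Real.exp (-x ^ 2)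
  rw [neg_neg] at h
  rw [← h]
  simp [eval_comp]

theorem hermiteFunctional_X_mul_comp_sq (hα : -1 < α) (p : ℝ[X]) :
    hermiteFunctional α z (X * p.comp (X ^ 2)) = 0 := by
  have h := hermiteFunctional_comp_neg (α := α) (z := z) (X * p.comp (X ^ 2))
  have e : (X * p.comp (X ^ 2)).comp (-X) = -(X * p.comp (X ^ 2)) := by
    simp [comp_assoc]
  rw [e, ← coe_hermiteLin hα, map_neg] at h
  rw [← coe_hermiteLin hα]
  linarith

theorem hermiteFunctional_comp_sq (hα : -1 < α) (hz : 0 < z) (p : ℝ[X]) :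
    hermiteFunctional α z (p.comp (X ^ 2)) = laguerreFunctional α z p := by
  set f : ℝ → ℝ := fun x => p.eval (x ^ 2) * (|x| ^ (2 * α + 1) * Real.exp (-x ^ 2)) with hf
  have hfi : ∀ a b, IntervalIntegrable f volume a b := fun a b =>
    (intervalIntegrable_hermiteWeight hα a b).continuousOn_mul
      (p.continuous.comp (continuous_pow 2)).continuousOn
  have hL : hermiteFunctional α z (p.comp (X ^ 2)) = ∫ x in (-√z)..√z, f x := by
    simp only [hermiteFunctional, eval_comp, eval_pow, eval_X, hf, mul_assoc]
  have hneg : ∫ x in (-√z)..0, f x = ∫ x in (0 : ℝ)..√z, f x := by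
    have h := intervalIntegral.integral_comp_neg (a := 0) (b := √z) f
    rw [neg_zero] at h
    rw [← h]
    simp [hf]
  have hpt : ∀ x : ℝ, 0 < x → f x * 2 =
      p.eval (x ^ 2) * (x ^ 2) ^ α * Real.exp (-x ^ 2) * (2 * x) := by
    intro x hx
    have e : |x| ^ (2 * α + 1) = (x ^ 2) ^ α * x := by
      rw [abs_of_pos hx, Real.rpow_add_one hx.ne', Real.rpow_mul hx.le, Real.rpow_two]
    simp only [hf, e]
    ring
  have hs : (0 : ℝ) ≤ √z := Real.sqrt_nonneg z
  have himg : (fun x : ℝ => x ^ 2) '' Set.uIcc 0 √z ⊆ Set.Icc 0 z := by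
    rintro _ ⟨x, hx, rfl⟩
    rw [Set.uIcc_of_le hs] at hx
    refine ⟨sq_nonneg x, ?_⟩
    calc x ^ 2 ≤ √z ^ 2 := pow_le_pow_left₀ hx.1 hx.2 2
      _ = z := Real.sq_sqrt hz.le
  -- `x^α` may be singular at `0`, so this change of variables asks continuity of the integrand only
  -- on the image of the open interval.
  have hcv := intervalIntegral.integral_comp_mul_deriv''' (a := 0) (b := √z)
    (f := fun x => x ^ 2) (f' := fun x => 2 * x)
    (g := fun x => p.eval x * x ^ α * Real.exp (-x)) (by fun_prop)
    (fun x _ => by simpa using (hasDerivAt_pow 2 x).hasDerivWithinAt) ?_ ?_ ?_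
  · simp only [Function.comp_def] at hcv
    rw [hL, ← intervalIntegral.integral_add_adjacent_intervals (hfi _ 0) (hfi 0 _), hneg,
      ← mul_two, ← intervalIntegral.integral_mul_const, laguerreFunctional,
      ← Real.sq_sqrt hz.le, Real.sqrt_sq hs]
    rw [zero_pow two_ne_zero] at hcv
    rw [← hcv]
    refine intervalIntegral.integral_congr_ae (Filter.Eventually.of_forall fun x hx => ?_)
    rw [Set.uIoc_of_le hs] at hx
    exact hpt x hx.1
  · refine (p.continuousOn.mul ?_).mul (by fun_prop)
    refine continuousOn_id.rpow_const fun x hx => Or.inl ?_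
    obtain ⟨y, hy, rfl⟩ := hx
    rw [min_eq_left hs] at hy
    exact (pow_pos hy.1 2).ne'
  · refine IntegrableOn.mono_set ?_ himg
    have h := (intervalIntegrable_laguerreWeight hα 0 z).continuousOn_mul p.continuousOn
    rw [intervalIntegrable_iff_integrableOn_Icc_of_le hz.le] at h
    simpa only [mul_assoc] using h
  · rw [Set.uIcc_of_le hs, integrableOn_Icc_iff_integrableOn_Ioc]
    have h := ((hfi 0 √z).mul_const 2).1
    refine h.congr_fun (fun x hx => ?_) measurableSet_Ioc
    exact hpt x hx.1

end Functionals

/-! ### Zeros of `P_n`: location of the extra charge and the field. -/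

section Laguerre

variable {α z : ℝ}

theorem isSMOP_polyP (hα : -1 < α) (hz : 0 < z) : IsSMOP (laguerreLin hα z) (polyP α z) := by
  have h := isSMOP_monicOrthPoly (positiveOn_laguerreLin hα hz)
  rw [coe_laguerreLin] at h ⊢
  exact h

theorem polyP_eval_ne_zero (hα : -1 < α) (hz : 0 < z) (n : ℕ) {x : ℝ} (hx : x ∉ Set.Ioo 0 z) :
    (polyP α z n).eval x ≠ 0 := by
  obtain ⟨r, -, hr, hp⟩ := (isSMOP_polyP hα hz).exists_zeros (positiveOn_laguerreLin hα hz) n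
  rw [hp, eval_prod]
  refine Finset.prod_ne_zero_iff.2 fun k _ => ?_
  rw [eval_sub, eval_X, eval_C]
  exact sub_ne_zero.2 fun e => hx (e ▸ hr k)

theorem coeffB_lt (hα : -1 < α) (hz : 0 < z) (n : ℕ) : coeffB α z n < 2 * n + α + 1 := by
  have h := diagCoeff_lt (hasBoundaryPearson_laguerreLin hα hz)
    (mul_pos (Real.rpow_pos_of_pos hz _) (Real.exp_pos _)) (positiveOn_laguerreLin hα hz)
    (isSMOP_polyP hα hz) (polyP_eval_ne_zero hα hz n fun h => lt_irrefl _ h.2)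
  rwa [coe_laguerreLin] at h

theorem lt_chargeβ (hα : -1 < α) (hz : 0 < z) (n : ℕ) : z < chargeβ α z n := by
  have := coeffB_lt hα hz (n + 1)
  push_cast at this
  unfold chargeβ
  linarith

/-- The derivative of `potentialP`. -/
def potentialPDeriv (α z β x : ℝ) : ℝ := 1 / (z - x) - (α + 1) / x - 1 / (β - x) + 1

theorem hasDerivAt_potentialP {β x : ℝ} (hβ : z < β) (hx : x ∈ Set.Ioo 0 z) :
    HasDerivAt (potentialP α z β) (potentialPDeriv α z β x) x := by
  have hxβ : x < β := hx.2.trans hβ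
  have h0 := hasDerivAt_log_one_div_abs_sub (c := 0) hx.1.ne'
  simp only [sub_zero] at h0
  have := (((hasDerivAt_log_one_div_abs_sub hx.2.ne).add h0).sub
    (hasDerivAt_log_one_div_abs_sub hxβ.ne)).add
      ((hasDerivAt_id x).sub ((Real.hasDerivAt_log hx.1.ne').const_mul α))
  refine this.congr_deriv ?_
  rw [potentialPDeriv, ← neg_sub z x, ← neg_sub β x, one_div_neg_eq_neg_one_div,
    one_div_neg_eq_neg_one_div]
  ring

/-- The attracting charge at `β` lies beyond the repelling one at `z`, and their joint force `(β -
z) / ((z - t) (β - t))` increases with `t`. -/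
theorem strictMonoOn_potentialPDeriv (hα : -1 < α) {β : ℝ} (hβ : z < β) :
    StrictMonoOn (potentialPDeriv α z β) (Set.Ioo 0 z) := by
  intro x hx y hy hxy
  have h1 : ∀ t < z, 1 / (z - t) - 1 / (β - t) = (β - z) / ((z - t) * (β - t)) := by
    intro t ht
    have : z - t ≠ 0 := (sub_pos.2 ht).ne'
    have : β - t ≠ 0 := (sub_pos.2 (ht.trans hβ)).ne'
    field_simp
    ring
  have h2 : (β - z) / ((z - x) * (β - x)) < (β - z) / ((z - y) * (β - y)) := by
    have hy1 : 0 < z - y := sub_pos.2 hy.2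
    have hy2 : 0 < β - y := sub_pos.2 (hy.2.trans hβ)
    refine div_lt_div_of_pos_left (sub_pos.2 hβ) (mul_pos hy1 hy2) ?_
    exact mul_lt_mul'' (by linarith) (by linarith) hy1.le hy2.le
  have h3 : (α + 1) / y < (α + 1) / x := div_lt_div_of_pos_left (by linarith) hx.1 hxy
  rw [← h1 x hx.2, ← h1 y hy.2] at h2
  unfold potentialPDeriv
  linarith

/-- The differential equation of `P_{n+1}` at its zeros, in terms of the external field. -/
theorem derivative_derivative_polyP_eval (hα : -1 < α) (hz : 0 < z) (n : ℕ) {x : ℝ}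
    (hp : (polyP α z (n + 1)).eval x = 0) :
    (derivative (derivative (polyP α z (n + 1)))).eval x =
      potentialPDeriv α z (chargeβ α z n) x * (derivative (polyP α z (n + 1))).eval x := by
  have hx : x ∈ Set.Ioo 0 z := by
    by_contra hx
    exact polyP_eval_ne_zero hα hz _ hx hp
  have h := pearsonφ_mul_derivative_eval_eq (hasBoundaryPearson_laguerreLin hα hz)
    (positiveOn_laguerreLin hα hz) (isSMOP_polyP hα hz) n hp
  rw [coe_laguerreLin] at h
  change _ = (x - chargeβ α z n) * _ at h
  have h1 : x ≠ 0 := hx.1.ne'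
  have h2 : z - x ≠ 0 := (sub_pos.2 hx.2).ne'
  have h3 : chargeβ α z n - x ≠ 0 := (sub_pos.2 (hx.2.trans (lt_chargeβ hα hz n))).ne'
  simp only [pearsonOp, pearsonφ, pearsonψ, eval_add, eval_sub, eval_mul, eval_X, eval_C] at h
  have hV : x * (z - x) * (chargeβ α z n - x) * potentialPDeriv α z (chargeβ α z n) x =
      -(x * (z - x)) - (chargeβ α z n - x) * (x * x - (z + α + 2) * x + (α + 1) * z) := by
    unfold potentialPDeriv
    field_simp
    ring
  refine mul_left_cancel₀ (mul_ne_zero (mul_ne_zero h1 h2) h3) ?_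
  rw [← mul_assoc, hV]
  linear_combination h

end Laguerre

/-! ### Symmetrization: zeros of `S_n`. -/

section Hermite

variable {α z : ℝ}

theorem polyS_two_mul (α z : ℝ) (n : ℕ) : polyS α z (2 * n) = (polyP α z n).comp (X ^ 2) := by
  rw [polyS, if_pos (even_two_mul n), Nat.mul_div_cancel_left n two_pos]

theorem polyS_two_mul_add_one (hz : 0 < z) (n : ℕ) :
    polyS α z (2 * n + 1) = X * (polyP (α + 1) z n).comp (X ^ 2) := by
  rw [polyS, if_neg (Nat.not_even_two_mul_add_one n), polyQ_eq hz]
  congr 3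
  omega

theorem isSMOP_polyS (hα : -1 < α) (hz : 0 < z) : IsSMOP (hermiteLin hα z) (polyS α z) := by
  have hα1 : -1 < α + 1 := by linarith
  have hP := isSMOP_polyP hα hz
  have hQ := isSMOP_polyP hα1 hz
  have hX2 : (X ^ 2 : ℝ[X]).natDegree = 2 := natDegree_X_pow 2
  have hee : ∀ p q : ℝ[X], hermiteLin hα z (p.comp (X ^ 2) * q.comp (X ^ 2)) =
      laguerreLin hα z (p * q) := by
    intro p q
    rw [← mul_comp, coe_hermiteLin, coe_laguerreLin, hermiteFunctional_comp_sq hα hz]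
  have hoo : ∀ p q : ℝ[X], hermiteLin hα z ((X * p.comp (X ^ 2)) * (X * q.comp (X ^ 2))) =
      laguerreLin hα1 z (p * q) := by
    intro p q
    have e : (X * p.comp (X ^ 2)) * (X * q.comp (X ^ 2)) = (X * (p * q)).comp (X ^ 2) := by
      rw [mul_comp, mul_comp, X_comp]
      ring
    rw [e, coe_hermiteLin, coe_laguerreLin, hermiteFunctional_comp_sq hα hz,
      laguerreFunctional_X_mul hz]
  have heo : ∀ p q : ℝ[X], hermiteLin hα z (p.comp (X ^ 2) * (X * q.comp (X ^ 2))) = 0 := by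
    intro p q
    rw [mul_left_comm, ← mul_comp, coe_hermiteLin, hermiteFunctional_X_mul_comp_sq hα]
  refine ⟨fun n => ?_, fun m n hmn => ?_, fun n => ?_⟩
  · obtain ⟨k, rfl | rfl⟩ := n.even_or_odd'
    · rw [polyS_two_mul]
      refine ⟨(hP.monic k).comp (monic_X_pow 2) (by rw [hX2]; exact two_ne_zero), ?_⟩
      rw [natDegree_comp, hX2, hP.natDegree_eq, mul_comm]
    · have hm : ((polyP (α + 1) z k).comp (X ^ 2)).Monic :=
        (hQ.monic k).comp (monic_X_pow 2) (by rw [hX2]; exact two_ne_zero)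
      rw [polyS_two_mul_add_one hz]
      refine ⟨monic_X.mul hm, ?_⟩
      rw [natDegree_X_mul hm.ne_zero, natDegree_comp, hX2, hQ.natDegree_eq, mul_comm]
  · obtain ⟨k, rfl | rfl⟩ := m.even_or_odd' <;> obtain ⟨l, rfl | rfl⟩ := n.even_or_odd' <;>
      simp only [polyS_two_mul, polyS_two_mul_add_one hz]
    · rw [hee, hP.2.1 k l (by omega)]
    · rw [heo]
    · rw [mul_comm, heo]
    · rw [hoo, hQ.2.1 k l (by omega)]
  · obtain ⟨k, rfl | rfl⟩ := n.even_or_odd' <;> simp only [polyS_two_mul, polyS_two_mul_add_one hz]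
    · rw [hee]; exact hP.2.2 k
    · rw [hoo]; exact hQ.2.2 k

theorem diagCoeff_polyS (hα : -1 < α) (hz : 0 < z) :
    diagCoeff (hermiteFunctional α z) (polyS α z) = fun _ => 0 := by
  funext n
  rw [diagCoeff, div_eq_zero_iff]
  left
  obtain ⟨k, rfl | rfl⟩ := n.even_or_odd'
  · rw [polyS_two_mul, ← mul_comp, hermiteFunctional_X_mul_comp_sq hα]
  · rw [polyS_two_mul_add_one hz]
    have e : X * ((X * (polyP (α + 1) z k).comp (X ^ 2)) * (X * (polyP (α + 1) z k).comp (X ^ 2))) =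
        X * (X * (polyP (α + 1) z k * polyP (α + 1) z k)).comp (X ^ 2) := by
      rw [mul_comp, mul_comp, X_comp]
      ring
    rw [e, hermiteFunctional_X_mul_comp_sq hα]

theorem hasThreeTermRecurrence_polyS (hα : -1 < α) (hz : 0 < z) :
    HasThreeTermRecurrence (polyS α z) (fun _ => 0) (coeffγ α z) := by
  have h := (isSMOP_polyS hα hz).hasThreeTermRecurrence (positiveOn_hermiteLin hα hz)
  rw [coe_hermiteLin, diagCoeff_polyS hα hz] at h
  exact h

/-- Pythagoras for `x S_{n+1} = S_{n+2} + γ_{n+1} S_n`. In the variable `x²` the right side is the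
numerator of a diagonal coefficient of `P` or `Q`. -/
theorem coeffγ_add_coeffγ_mul (hα : -1 < α) (hz : 0 < z) (n : ℕ) :
    (coeffγ α z (n + 1) + coeffγ α z (n + 2)) *
        hermiteFunctional α z (polyS α z (n + 1) * polyS α z (n + 1)) =
      hermiteFunctional α z (X * polyS α z (n + 1) * (X * polyS α z (n + 1))) := by
  have h := isSMOP_polyS hα hz
  have hγ : ∀ k, coeffγ α z (k + 1) * hermiteLin hα z (polyS α z k * polyS α z k) =
      hermiteLin hα z (polyS α z (k + 1) * polyS α z (k + 1)) := by
    intro k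
    have := subdiagCoeff_mul h k
    rwa [coe_hermiteLin] at this ⊢
  rw [(hasThreeTermRecurrence_polyS hα hz).2.2 n, ← coe_hermiteLin hα, C_0, zero_mul, add_zero]
  have e : (polyS α z (n + 2) + C (coeffγ α z (n + 1)) * polyS α z n) *
      (polyS α z (n + 2) + C (coeffγ α z (n + 1)) * polyS α z n) =
      polyS α z (n + 2) * polyS α z (n + 2) +
        C (2 * coeffγ α z (n + 1)) * (polyS α z (n + 2) * polyS α z n) +
        C (coeffγ α z (n + 1)) * (C (coeffγ α z (n + 1)) * (polyS α z n * polyS α z n)) := by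
    rw [C_mul, map_ofNat]
    ring
  rw [e, map_add, map_add, map_C_mul, map_C_mul, map_C_mul, hγ n, h.2.1 (n + 2) n (by omega),
    ← hγ (n + 1)]
  ring

theorem coeffγ_add_coeffγ_even (hα : -1 < α) (hz : 0 < z) (m : ℕ) :
    coeffγ α z (2 * (m + 1)) + coeffγ α z (2 * (m + 1) + 1) = coeffB α z (m + 1) := by
  have h := coeffγ_add_coeffγ_mul hα hz (2 * m + 1)
  rw [show 2 * m + 1 + 1 = 2 * (m + 1) by ring, polyS_two_mul, ← mul_comp,
    hermiteFunctional_comp_sq hα hz] at h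
  have e : X * (polyP α z (m + 1)).comp (X ^ 2) * (X * (polyP α z (m + 1)).comp (X ^ 2)) =
      (X * (polyP α z (m + 1) * polyP α z (m + 1))).comp (X ^ 2) := by
    rw [mul_comp, mul_comp, X_comp]
    ring
  rw [e, hermiteFunctional_comp_sq hα hz] at h
  have hne := (isSMOP_polyP hα hz).2.2 (m + 1)
  rw [coe_laguerreLin] at hne
  exact (eq_div_iff hne).2 h

theorem coeffγ_add_coeffγ_odd (hα : -1 < α) (hz : 0 < z) (m : ℕ) :
    coeffγ α z (2 * m + 1) + coeffγ α z (2 * m + 2) = coeffB (α + 1) z m := by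
  have hα1 : -1 < α + 1 := by linarith
  have h := coeffγ_add_coeffγ_mul hα hz (2 * m)
  set q := polyP (α + 1) z m with hq
  have e0 : (X * q.comp (X ^ 2)) * (X * q.comp (X ^ 2)) = (X * (q * q)).comp (X ^ 2) := by
    rw [mul_comp, mul_comp, X_comp]
    ring
  have e : X * (X * q.comp (X ^ 2)) * (X * (X * q.comp (X ^ 2))) =
      (X * (X * (q * q))).comp (X ^ 2) := by
    rw [mul_comp, mul_comp, mul_comp, X_comp]
    ring
  rw [polyS_two_mul_add_one hz, ← hq, e, e0, hermiteFunctional_comp_sq hα hz,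
    hermiteFunctional_comp_sq hα hz, laguerreFunctional_X_mul hz,
    laguerreFunctional_X_mul hz] at h
  have hne := (isSMOP_polyP hα1 hz).2.2 m
  rw [coe_laguerreLin] at hne
  exact (eq_div_iff hne).2 h

theorem chargeρ_even (hα : -1 < α) (hz : 0 < z) (m : ℕ) :
    chargeρ α z (2 * m + 1) = chargeβ α z m := by
  have h := coeffγ_add_coeffγ_even hα hz m
  rw [chargeρ, chargeβ, ← h]
  push_cast
  ring_nf

/-- Kept apart from the next lemma because `m = 0` corresponds to no `β`; the bound `ρ_0 > z` needs
it. -/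
theorem chargeρ_odd (hα : -1 < α) (hz : 0 < z) (m : ℕ) :
    chargeρ α z (2 * m) = -coeffB (α + 1) z m + (2 * m + α + z + 2) := by
  rw [chargeρ, ← coeffγ_add_coeffγ_odd hα hz m]
  push_cast
  ring

theorem chargeρ_odd_succ (hα : -1 < α) (hz : 0 < z) (m : ℕ) :
    chargeρ α z (2 * (m + 1)) = chargeβ (α + 1) z m := by
  rw [chargeρ_odd hα hz, chargeβ]
  push_cast
  ring

theorem lt_chargeρ (hα : -1 < α) (hz : 0 < z) (n : ℕ) : z < chargeρ α z n := by
  obtain ⟨k, rfl | rfl⟩ := n.even_or_odd'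
  · have := coeffB_lt (by linarith : -1 < α + 1) hz k
    rw [chargeρ_odd hα hz]
    linarith
  · rw [chargeρ_even hα hz]
    exact lt_chargeβ hα hz k

/-- The derivative of `potentialSReg`. -/
def potentialSRegDeriv (z ρ y : ℝ) : ℝ := 2 * y / (z - y ^ 2) - 2 * y / (ρ - y ^ 2) + 2 * y

theorem sq_lt_of_mem_Ioo_sqrt {w y : ℝ} (hy : y ∈ Set.Ioo (-√w) (√w)) : y ^ 2 < w := by
  rw [← sq_abs]
  exact (Real.lt_sqrt (abs_nonneg y)).1 (abs_lt.2 hy)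

theorem hasDerivAt_log_sub_sqrt_add_log_add_sqrt {w y : ℝ} (hy : y ∈ Set.Ioo (-√w) (√w)) :
    HasDerivAt (fun t => Real.log (1 / |t - √w|) + Real.log (1 / |t + √w|))
      (2 * y / (w - y ^ 2)) y := by
  have h1 := hasDerivAt_log_one_div_abs_sub hy.2.ne
  have h2 := hasDerivAt_log_one_div_abs_sub hy.1.ne'
  simp only [sub_neg_eq_add] at h2
  refine (h1.add h2).congr_deriv ?_
  have e1 : y - √w ≠ 0 := sub_ne_zero.2 hy.2.ne
  have e2 : y + √w ≠ 0 := by linarith [hy.1]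
  have hw : 0 ≤ w := (sq_nonneg y).trans (sq_lt_of_mem_Ioo_sqrt hy).le
  have e3 : w - y ^ 2 = -((y - √w) * (y + √w)) := by
    linear_combination -(Real.sq_sqrt hw)
  rw [e3]
  field_simp
  ring

theorem hasDerivAt_potentialSReg {ρ y : ℝ} (hρ : z < ρ) (hy : y ∈ Set.Ioo (-√z) (√z)) :
    HasDerivAt (potentialSReg z ρ) (potentialSRegDeriv z ρ y) y := by
  have hs : √z ≤ √ρ := Real.sqrt_le_sqrt hρ.le
  have hy' : y ∈ Set.Ioo (-√ρ) (√ρ) := ⟨by linarith [hy.1], by linarith [hy.2]⟩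
  have h := ((hasDerivAt_log_sub_sqrt_add_log_add_sqrt hy).sub
    (hasDerivAt_log_sub_sqrt_add_log_add_sqrt hy')).add (hasDerivAt_pow 2 y)
  refine (h.congr_deriv ?_).congr_of_eventuallyEq (Filter.Eventually.of_forall fun t => ?_)
  · simp [potentialSRegDeriv]
  · simp only [potentialSReg, Pi.add_apply, Pi.sub_apply]
    ring

theorem hasDerivAt_potentialS {ρ y : ℝ} (hρ : z < ρ) (hy : y ∈ Set.Ioo (-√z) (√z)) (hy0 : y ≠ 0) :
    HasDerivAt (potentialS α z ρ) (potentialSRegDeriv z ρ y - (2 * α + 1) / y) y := by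
  have h := (hasDerivAt_potentialSReg hρ hy).sub ((Real.hasDerivAt_log hy0).const_mul (2 * α + 1))
  refine (h.congr_deriv (by rw [div_eq_mul_inv])).congr_of_eventuallyEq
    (Filter.Eventually.of_forall fun t => ?_)
  simp only [potentialS, Pi.sub_apply, Real.log_abs]

theorem derivative_comp_sq (p : ℝ[X]) :
    derivative (p.comp (X ^ 2)) = C 2 * X * (derivative p).comp (X ^ 2) := by
  rw [derivative_comp, derivative_X_pow]
  norm_num

/-- The differential equation of `S_{n+1}` at its nonzero zeros, in terms of the external field. -/
theorem derivative_derivative_polyS_eval (hα : -1 < α) (hz : 0 < z) (n : ℕ) {y : ℝ}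
    (hy : y ∈ Set.Ioo (-√z) (√z)) (hy0 : y ≠ 0) (hS : (polyS α z (n + 1)).eval y = 0) :
    (derivative (derivative (polyS α z (n + 1)))).eval y =
      (potentialSRegDeriv z (chargeρ α z n) y - (2 * α + 1) / y) *
        (derivative (polyS α z (n + 1))).eval y := by
  have hyz := sq_lt_of_mem_Ioo_sqrt hy
  have h1 : z - y ^ 2 ≠ 0 := (sub_pos.2 hyz).ne'
  have h2 : chargeρ α z n - y ^ 2 ≠ 0 := (sub_pos.2 (hyz.trans (lt_chargeρ hα hz n))).ne'
  obtain ⟨k, rfl | rfl⟩ := n.even_or_odd'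
  · rw [polyS_two_mul_add_one hz] at hS ⊢
    have hq : (polyP (α + 1) z k).eval (y ^ 2) = 0 := by
      simpa [hy0, eval_comp] using hS
    -- For `k = 0` the polynomial is `S_1 = x`, which has no nonzero root.
    rcases k with _ | k
    · simp [(isSMOP_polyP (by linarith : -1 < α + 1) hz).zero_eq_one] at hq
    · have hd := derivative_derivative_polyP_eval (by linarith : -1 < α + 1) hz k hq
      rw [← chargeρ_odd_succ hα hz] at hd
      simp only [derivative_mul, derivative_add, derivative_comp_sq, derivative_X, derivative_C,
        eval_add, eval_mul, eval_X, eval_C, eval_comp, eval_pow, zero_mul, zero_add, one_mul, mul_one, hq, hd]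
      unfold potentialPDeriv potentialSRegDeriv
      field_simp
      ring
  · rw [show 2 * k + 1 + 1 = 2 * (k + 1) by ring, polyS_two_mul] at hS ⊢
    have hq : (polyP α z (k + 1)).eval (y ^ 2) = 0 := by
      simpa [eval_comp] using hS
    have hd := derivative_derivative_polyP_eval hα hz k hq
    rw [← chargeρ_even hα hz] at hd
    simp only [derivative_mul, derivative_comp_sq, derivative_X, derivative_C, eval_add, eval_mul,
      -- By the chain rule `S'' = 4 y² P'' + 2 P'`; the extra `2 P'` turns the coefficient `α + 1`
      -- at the origin into `2α + 1`.
      eval_X, eval_C, eval_comp, eval_pow, zero_mul, zero_add, mul_one, hd]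
    unfold potentialPDeriv potentialSRegDeriv
    field_simp
    ring

/-- Even-index `S` do not vanish at `0`, since `P_k(0) ≠ 0`; odd-index ones are odd functions, and
so are their second derivatives. -/
theorem derivative_derivative_polyS_eval_zero (hα : -1 < α) (hz : 0 < z) (n : ℕ)
    (hS : (polyS α z n).eval 0 = 0) : (derivative (derivative (polyS α z n))).eval 0 = 0 := by
  obtain ⟨k, rfl | rfl⟩ := n.even_or_odd'
  · rw [polyS_two_mul, eval_comp, eval_pow, eval_X, zero_pow two_ne_zero] at hS
    exact absurd hS (polyP_eval_ne_zero hα hz k fun h => lt_irrefl _ h.1)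
  · rw [polyS_two_mul_add_one hz]
    simp [derivative_mul, derivative_comp_sq]

end Hermite

end TruncatedLaguerre

end

theorem mainTheorem8 (α z : ℝ) (hα : -1 < α) (hz : 0 < z) :
    -- the objects are the monic orthogonal polynomials and their recurrence coefficients
    (TruncatedLaguerre.IsSMOP (TruncatedLaguerre.laguerreFunctional α z)
        (TruncatedLaguerre.polyP α z) ∧
      TruncatedLaguerre.HasThreeTermRecurrence (TruncatedLaguerre.polyP α z)
        (TruncatedLaguerre.coeffB α z) (TruncatedLaguerre.coeffA α z) ∧
      TruncatedLaguerre.IsSMOP (TruncatedLaguerre.hermiteFunctional α z)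
        (TruncatedLaguerre.polyS α z) ∧
      TruncatedLaguerre.HasThreeTermRecurrence (TruncatedLaguerre.polyS α z)
        (fun _ => 0) (TruncatedLaguerre.coeffγ α z)) ∧
    ∀ n : ℕ,
      -- the zeros of P_{n+1}
      (z < TruncatedLaguerre.chargeβ α z n ∧
        ∃ x : Fin (n + 1) → ℝ, StrictMono x ∧ (∀ k, x k ∈ Set.Ioo 0 z) ∧
          TruncatedLaguerre.polyP α z (n + 1) =
            ∏ k, (Polynomial.X - Polynomial.C (x k)) ∧
          (∀ k, TruncatedLaguerre.InEquilibriumAt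
            (TruncatedLaguerre.potentialP α z (TruncatedLaguerre.chargeβ α z n)) x k) ∧
          ∀ x' : Fin (n + 1) → ℝ, StrictMono x' → (∀ k, x' k ∈ Set.Ioo 0 z) →
            (∀ k, TruncatedLaguerre.InEquilibriumAt
              (TruncatedLaguerre.potentialP α z (TruncatedLaguerre.chargeβ α z n)) x' k) →
            x' = x) ∧
      -- the zeros of S_{n+1}
      (z < TruncatedLaguerre.chargeρ α z n ∧
        ∃ y : Fin (n + 1) → ℝ, StrictMono y ∧ (∀ k, y k ∈ Set.Ioo (-√z) (√z)) ∧
          TruncatedLaguerre.polyS α z (n + 1) =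
            ∏ k, (Polynomial.X - Polynomial.C (y k)) ∧
          (∀ k, y k ≠ 0 → TruncatedLaguerre.InEquilibriumAt
            (TruncatedLaguerre.potentialS α z (TruncatedLaguerre.chargeρ α z n)) y k) ∧
          (∀ k, y k = 0 → TruncatedLaguerre.InEquilibriumAt
            (TruncatedLaguerre.potentialSReg z (TruncatedLaguerre.chargeρ α z n)) y k)) := by
  refine ⟨⟨?_, ?_, ?_, TruncatedLaguerre.hasThreeTermRecurrence_polyS hα hz⟩,
    fun n => ⟨⟨TruncatedLaguerre.lt_chargeβ hα hz n, ?_⟩,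
      TruncatedLaguerre.lt_chargeρ hα hz n, ?_⟩⟩
  · simpa only [TruncatedLaguerre.coe_laguerreLin] using TruncatedLaguerre.isSMOP_polyP hα hz
  · have h := (TruncatedLaguerre.isSMOP_polyP hα hz).hasThreeTermRecurrence
      (TruncatedLaguerre.positiveOn_laguerreLin hα hz)
    rwa [TruncatedLaguerre.coe_laguerreLin] at h
  · simpa only [TruncatedLaguerre.coe_hermiteLin] using TruncatedLaguerre.isSMOP_polyS hα hz
  · obtain ⟨x, hmono, hmem, hprod⟩ := (TruncatedLaguerre.isSMOP_polyP hα hz).exists_zeros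
      (TruncatedLaguerre.positiveOn_laguerreLin hα hz) (n + 1)
    have hV := fun t => TruncatedLaguerre.hasDerivAt_potentialP (α := α) (x := t)
      (TruncatedLaguerre.lt_chargeβ hα hz n)
    have heq : ∀ k, TruncatedLaguerre.InEquilibriumAt
        (TruncatedLaguerre.potentialP α z (TruncatedLaguerre.chargeβ α z n)) x k := by
      intro k
      refine (TruncatedLaguerre.inEquilibriumAt_iff_derivative hmono.injective hprod
        (hV _ (hmem k))).2
        (TruncatedLaguerre.derivative_derivative_polyP_eval hα hz n ?_)
      rw [hprod, Polynomial.eval_prod]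
      exact Finset.prod_eq_zero (Finset.mem_univ k) (by simp)
    refine ⟨x, hmono, hmem, hprod, heq, fun x' hmono' hmem' heq' => ?_⟩
    exact TruncatedLaguerre.equilibrium_unique hV
      (TruncatedLaguerre.strictMonoOn_potentialPDeriv hα (TruncatedLaguerre.lt_chargeβ hα hz n))
      hmono' hmono hmem' hmem heq' heq
  · obtain ⟨y, hmono, hmem, hprod⟩ := (TruncatedLaguerre.isSMOP_polyS hα hz).exists_zeros
      (TruncatedLaguerre.positiveOn_hermiteLin hα hz) (n + 1)
    have hρ := TruncatedLaguerre.lt_chargeρ hα hz n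
    have hroot : ∀ k, (TruncatedLaguerre.polyS α z (n + 1)).eval (y k) = 0 := by
      intro k
      rw [hprod, Polynomial.eval_prod]
      exact Finset.prod_eq_zero (Finset.mem_univ k) (by simp)
    refine ⟨y, hmono, hmem, hprod, fun k hk => ?_, fun k hk => ?_⟩
    · exact (TruncatedLaguerre.inEquilibriumAt_iff_derivative hmono.injective hprod
        (TruncatedLaguerre.hasDerivAt_potentialS hρ (hmem k) hk)).2
        (TruncatedLaguerre.derivative_derivative_polyS_eval hα hz n (hmem k) hk (hroot k))
    · refine (TruncatedLaguerre.inEquilibriumAt_iff_derivative hmono.injective hprod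
        (TruncatedLaguerre.hasDerivAt_potentialSReg hρ (hmem k))).2 ?_
      have h0 := hroot k
      rw [hk] at h0 ⊢
      -- At the origin both sides vanish: the regular part of the field is even, so its derivative
      -- is zero there.
      rw [TruncatedLaguerre.derivative_derivative_polyS_eval_zero hα hz (n + 1) h0,
        TruncatedLaguerre.potentialSRegDeriv]
      ring
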